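/- Let $(M,J)$ be a compact complex manifold of complex dimension at least $2$, and let $g$ be a smooth Hermitian metric on $M$ (that is, a Riemannian metric with $g(J\cdot,J\cdot)=g$) which is locally conformally Kähler: every point of $M$ has an open neighbourhood $U$ with a smooth function $f:U\to\mathbb{R}$ such that the metric $e^{-f}g$ is Kähler on $U$. Let $\theta$ be the Lee form, i.e. the global closed $1$-form with $\theta=df$ on each such $U$; equivalently, $\theta$ is closed and $d\Omega=\theta\wedge\Omega$ for $\Omega:=g(J\cdot,\cdot)$. Let $\nabla$ be the Levi-Civita connection of $g$. Suppose that $(M,J,g)$ is pluricanonical, i.e. $(\nabla\theta)^{1,1}=0$, which means $(\nabla_X\theta)(Y)+(\nabla_{JX}\theta)(JY)=0$ for all vector fields $X,Y$ on $M$. Then $(M,J,g)$ is Vaisman, i.e. $\nabla\theta=0$. -/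

import Mathlib

open Bundle VectorField
open scoped Manifold ContDiff

namespace LCK

section LeviCivita

variable {E : Type*} [NormedAddCommGroup E] [NormedSpace ℝ E]
  {H : Type*} [TopologicalSpace H] {I : ModelWithCorners ℝ E H}
  {M : Type*} [TopologicalSpace M] [ChartedSpace H M] [IsManifold I ∞ M]

/-- A covariant derivative on the tangent bundle of a Riemannian manifold `(M, g)` is a Levi-Civita
connection if it is metric and torsion-free. In Mathlib's convention `cov Y x v` is `∇_v Y`. As usual
in Mathlib, a covariant derivative is also applied to non-differentiable vector fields, where
nothing is required of it and its values are never used below. -/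
structure IsLeviCivita (g : ContMDiffRiemannianMetric I ∞ E (TangentSpace I : M → Type _))
    (cov : CovariantDerivative I E (TangentSpace I : M → Type _)) : Prop where
  metric : ∀ (x : M) (Y Z : Π y : M, TangentSpace I y) (v : TangentSpace I x),
    MDiffAt (T% Y) x → MDiffAt (T% Z) x →
      mvfderiv I (fun y ↦ g.inner y (Y y) (Z y)) x v =
        g.inner x (cov Y x v) (Z x) + g.inner x (Y x) (cov Z x v)
  torsion_free : ∀ (x : M) (X Y : Π y : M, TangentSpace I y),
    MDiffAt (T% X) x → MDiffAt (T% Y) x →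
      cov Y x (X x) - cov X x (Y x) = mlieBracket I X Y x

/-- The right-hand side of the Koszul formula. -/
noncomputable def koszul (g : ContMDiffRiemannianMetric I ∞ E (TangentSpace I : M → Type _))
    (X Y Z : Π x : M, TangentSpace I x) (x : M) : ℝ :=
  mvfderiv I (fun y ↦ g.inner y (Y y) (Z y)) x (X x)
    + mvfderiv I (fun y ↦ g.inner y (X y) (Z y)) x (Y x)
    - mvfderiv I (fun y ↦ g.inner y (X y) (Y y)) x (Z x)
    + g.inner x (mlieBracket I X Y x) (Z x)
    - g.inner x (mlieBracket I X Z x) (Y x)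
    - g.inner x (mlieBracket I Y Z x) (X x)

theorem mdiffAt_inner (g : ContMDiffRiemannianMetric I ∞ E (TangentSpace I : M → Type _))
    {x : M} {Y Z : Π y : M, TangentSpace I y}
    (hY : MDiffAt (T% Y) x) (hZ : MDiffAt (T% Z) x) :
    MDiffAt (fun y ↦ g.inner y (Y y) (Z y)) x := by
  have : MDifferentiableAt I (I.prod 𝓘(ℝ))
      (fun m ↦ TotalSpace.mk' ℝ (E := Bundle.Trivial M ℝ) m (g.inner m (Y m) (Z m))) x := by
    apply MDifferentiableAt.clm_bundle_apply₂ (F₁ := E) (F₂ := E)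
    · exact g.contMDiff.mdifferentiableAt (by simp)
    · exact hY
    · exact hZ
  simp only [mdifferentiableAt_totalSpace] at this
  exact this.2

variable (g : ContMDiffRiemannianMetric I ∞ E (TangentSpace I : M → Type _))

theorem inner_ext {x : M} {u v : TangentSpace I x}
    (h : ∀ Z : Π y : M, TangentSpace I y, MDiffAt (T% Z) x →
      g.inner x u (Z x) = g.inner x v (Z x)) : u = v := by
  by_contra hne
  have := h _ (FiberBundle.mdifferentiableAt_extend I E (u - v))
  have h2 := g.pos x (u - v) (sub_ne_zero.2 hne)
  simp at this h2
  linarith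

/-- Uniqueness part of the fundamental theorem of Riemannian geometry. -/
theorem IsLeviCivita.unique {cov cov' : CovariantDerivative I E (TangentSpace I : M → Type _)}
    (h : IsLeviCivita g cov) (h' : IsLeviCivita g cov') {x : M} {Y : Π y : M, TangentSpace I y}
    (hY : MDiffAt (T% Y) x) : cov Y x = cov' Y x := by
  have key : ∀ (c : CovariantDerivative I E (TangentSpace I : M → Type _)), IsLeviCivita g c →
      ∀ X Z : Π y : M, TangentSpace I y, MDiffAt (T% X) x → MDiffAt (T% Z) x →
        2 * g.inner x (c Y x (X x)) (Z x) = koszul g X Y Z x := by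
    intro c hc X Z hX hZ
    simp only [koszul, ← hc.torsion_free x _ _ hX hY, ← hc.torsion_free x _ _ hX hZ,
      ← hc.torsion_free x _ _ hY hZ, hc.metric x _ _ _ hX hY, hc.metric x _ _ _ hX hZ,
      hc.metric x _ _ _ hY hZ]
    simp only [map_sub, sub_apply]
    rw [g.symm x (Y x) (c Z x (X x)), g.symm x (X x) (c Z x (Y x)), g.symm x (X x) (c Y x (Z x))]
    ring
  ext1 v
  have hv : MDiffAt (T% (FiberBundle.extend E v)) x := FiberBundle.mdifferentiableAt_extend I E v
  refine inner_ext g fun Z hZ ↦ ?_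
  have h1 := key cov h _ Z hv hZ
  have h2 := key cov' h' _ Z hv hZ
  simp only [FiberBundle.extend_apply_self] at h1 h2
  linarith

variable [FiniteDimensional ℝ E]

theorem tensorial_koszul_left {x : M} {Y Z : Π y : M, TangentSpace I y}
    (hY : MDiffAt (T% Y) x) (hZ : MDiffAt (T% Z) x) :
    TensorialAt I E (fun X ↦ koszul g X Y Z x) x where
  smul {f X} hf hX := by
    have e1 : (fun y ↦ g.inner y ((f • X) y) (Z y)) = fun y ↦ f y * g.inner y (X y) (Z y) := by
      ext y; simp
    have e2 : (fun y ↦ g.inner y ((f • X) y) (Y y)) = fun y ↦ f y * g.inner y (X y) (Y y) := by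
      ext y; simp
    simp only [koszul, e1, e2, mlieBracket_smul_left hf hX,
      mvfderiv_fun_mul hf (mdiffAt_inner g hX hZ), mvfderiv_fun_mul hf (mdiffAt_inner g hX hY)]
    simp [g.symm x (X x) (Y x), g.symm x (X x) (Z x)]
    ring
  add {X X'} hX hX' := by
    have e1 : (fun y ↦ g.inner y ((X + X') y) (Z y)) =
        fun y ↦ g.inner y (X y) (Z y) + g.inner y (X' y) (Z y) := by
      ext y; simp
    have e2 : (fun y ↦ g.inner y ((X + X') y) (Y y)) =
        fun y ↦ g.inner y (X y) (Y y) + g.inner y (X' y) (Y y) := by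
      ext y; simp
    simp only [koszul, e1, e2, mlieBracket_add_left hX hX',
      mvfderiv_fun_add (mdiffAt_inner g hX hZ) (mdiffAt_inner g hX' hZ),
      mvfderiv_fun_add (mdiffAt_inner g hX hY) (mdiffAt_inner g hX' hY)]
    simp
    ring

theorem tensorial_koszul_right {x : M} {X Y : Π y : M, TangentSpace I y}
    (hX : MDiffAt (T% X) x) (hY : MDiffAt (T% Y) x) :
    TensorialAt I E (fun Z ↦ koszul g X Y Z x) x where
  smul {f Z} hf hZ := by
    have e1 : (fun y ↦ g.inner y (Y y) ((f • Z) y)) = fun y ↦ f y * g.inner y (Y y) (Z y) := by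
      ext y; simp
    have e2 : (fun y ↦ g.inner y (X y) ((f • Z) y)) = fun y ↦ f y * g.inner y (X y) (Z y) := by
      ext y; simp
    simp only [koszul, e1, e2, mlieBracket_smul_right hf hZ,
      mvfderiv_fun_mul hf (mdiffAt_inner g hX hZ), mvfderiv_fun_mul hf (mdiffAt_inner g hY hZ)]
    simp [g.symm x (Z x)]
    ring
  add {Z Z'} hZ hZ' := by
    have e1 : (fun y ↦ g.inner y (Y y) ((Z + Z') y)) =
        fun y ↦ g.inner y (Y y) (Z y) + g.inner y (Y y) (Z' y) := by
      ext y; simp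
    have e2 : (fun y ↦ g.inner y (X y) ((Z + Z') y)) =
        fun y ↦ g.inner y (X y) (Z y) + g.inner y (X y) (Z' y) := by
      ext y; simp
    simp only [koszul, e1, e2, mlieBracket_add_right hZ hZ',
      mvfderiv_fun_add (mdiffAt_inner g hX hZ) (mdiffAt_inner g hX hZ'),
      mvfderiv_fun_add (mdiffAt_inner g hY hZ) (mdiffAt_inner g hY hZ')]
    simp
    ring

/-- For `Y` differentiable at `x`, the Koszul formula defines an endomorphism of `T_x M`. -/
theorem exists_koszul {x : M} {Y : Π y : M, TangentSpace I y} (hY : MDiffAt (T% Y) x) :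
    ∃ A : TangentSpace I x →L[ℝ] TangentSpace I x,
      ∀ X Z : Π y : M, TangentSpace I y, MDiffAt (T% X) x → MDiffAt (T% Z) x →
        2 * g.inner x (A (X x)) (Z x) = koszul g X Y Z x := by
  have : FiniteDimensional ℝ (TangentSpace I x) := inferInstanceAs (FiniteDimensional ℝ E)
  have : T2Space (TangentSpace I x) := inferInstanceAs (T2Space E)
  let B : TangentSpace I x →L[ℝ] TangentSpace I x →L[ℝ] ℝ :=
    TensorialAt.mkHom₂ (fun X Z ↦ koszul g X Y Z x) x
      (fun Z hZ ↦ tensorial_koszul_left g hY hZ) (fun X hX ↦ tensorial_koszul_right g hX hY)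
  let G : TangentSpace I x →ₗ[ℝ] Module.Dual ℝ (TangentSpace I x) :=
    { toFun v := (g.inner x v).toLinearMap
      map_add' _ _ := by ext; simp
      map_smul' _ _ := by ext; simp }
  have hG : Function.Injective G := by
    rw [injective_iff_map_eq_zero]
    intro v hv
    by_contra hne
    have h0 : g.inner x v v = 0 := congr($hv v)
    exact (g.pos x v hne).ne' h0
  let e := G.linearEquivOfInjective hG (Subspace.dual_finrank_eq).symm
  let C : TangentSpace I x →ₗ[ℝ] Module.Dual ℝ (TangentSpace I x) :=
    { toFun v := (B v).toLinearMap
      map_add' _ _ := by ext; simp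
      map_smul' _ _ := by ext; simp }
  refine ⟨LinearMap.toContinuousLinearMap ((1 / 2 : ℝ) • (e.symm.toLinearMap ∘ₗ C)), ?_⟩
  intro X Z hX hZ
  have h1 : ∀ v w, g.inner x (e.symm (C v)) w = B v w := by
    intro v w
    have : G (e.symm (C v)) = C v := e.apply_symm_apply (C v)
    exact congr($this w)
  have h2 : B (X x) (Z x) = koszul g X Y Z x := TensorialAt.mkHom₂_apply _ _ hX hZ
  simp [h1, h2]

set_option maxHeartbeats 2000000 in
/-- Existence part of the fundamental theorem of Riemannian geometry. -/
theorem exists_isLeviCivita :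
    ∃ cov : CovariantDerivative I E (TangentSpace I : M → Type _), IsLeviCivita g cov := by
  classical
  let D (Y : Π y : M, TangentSpace I y) (x : M) : TangentSpace I x →L[ℝ] TangentSpace I x :=
    if hY : MDiffAt (T% Y) x then (exists_koszul g hY).choose else 0
  have hD : ∀ {Y : Π y : M, TangentSpace I y} {x : M} (X Z : Π y : M, TangentSpace I y),
      MDiffAt (T% X) x → MDiffAt (T% Y) x → MDiffAt (T% Z) x →
        2 * g.inner x (D Y x (X x)) (Z x) = koszul g X Y Z x := by
    intro Y x X Z hX hY hZ
    simp only [D, dif_pos hY]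
    exact (exists_koszul g hY).choose_spec X Z hX hZ
  have hX : ∀ {x : M} (v : TangentSpace I x), ∃ X : Π y : M, TangentSpace I y,
      X x = v ∧ MDiffAt (T% X) x := fun v ↦
    ⟨_, FiberBundle.extend_apply_self E v, FiberBundle.mdifferentiableAt_extend I E v⟩
  refine ⟨⟨D, ⟨?_, ?_⟩⟩, ?_, ?_⟩
  · intro Y Y' x hY hY' _
    ext1 v
    obtain ⟨X, rfl, hX⟩ := hX v
    refine inner_ext g fun Z hZ ↦ ?_
    have h1 := hD X Z hX hY hZ
    have h2 := hD X Z hX hY' hZ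
    have h3 := hD X Z hX (mdifferentiableAt_add_section hY hY') hZ
    have e1 : (fun y ↦ g.inner y ((Y + Y') y) (Z y)) =
        fun y ↦ g.inner y (Y y) (Z y) + g.inner y (Y' y) (Z y) := by
      ext y; simp
    have e2 : (fun y ↦ g.inner y (X y) ((Y + Y') y)) =
        fun y ↦ g.inner y (X y) (Y y) + g.inner y (X y) (Y' y) := by
      ext y; simp
    simp only [koszul, e1, e2, mlieBracket_add_left hY hY', mlieBracket_add_right hY hY',
      mvfderiv_fun_add (mdiffAt_inner g hY hZ) (mdiffAt_inner g hY' hZ),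
      mvfderiv_fun_add (mdiffAt_inner g hX hY) (mdiffAt_inner g hX hY')] at h1 h2 h3
    simp at h1 h2 h3 ⊢
    linarith
  · intro Y f x hY hf _
    ext1 v
    obtain ⟨X, rfl, hX⟩ := hX v
    refine inner_ext g fun Z hZ ↦ ?_
    have h1 := hD X Z hX hY hZ
    have h3 := hD X Z hX (hf.smul_section hY) hZ
    have e1 : (fun y ↦ g.inner y ((f • Y) y) (Z y)) = fun y ↦ f y * g.inner y (Y y) (Z y) := by
      ext y; simp
    have e2 : (fun y ↦ g.inner y (X y) ((f • Y) y)) = fun y ↦ f y * g.inner y (X y) (Y y) := by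
      ext y; simp
    simp only [koszul, e1, e2, mlieBracket_smul_left hf hY, mlieBracket_smul_right hf hY,
      mvfderiv_fun_mul hf (mdiffAt_inner g hX hY), mvfderiv_fun_mul hf (mdiffAt_inner g hY hZ)]
      at h1 h3
    simp [g.symm x (Y x) (X x)] at h1 h3 ⊢
    linear_combination (1/2) * h3 - (1/2) * f x * h1
  · intro x Y Z v hY hZ
    obtain ⟨X, rfl, hX⟩ := hX v
    have h1 := hD X Z hX hY hZ
    have h2 := hD X Y hX hZ hY
    rw [g.symm x (Y x)]
    change _ = g.inner x (D Y x (X x)) (Z x) + g.inner x (D Z x (X x)) (Y x)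
    have e : (fun y ↦ g.inner y (Z y) (Y y)) = fun y ↦ g.inner y (Y y) (Z y) := by
      ext y; exact g.symm y _ _
    simp only [koszul, e, mlieBracket_swap_apply (V := Z) (W := Y)] at h1 h2
    simp at h1 h2
    linarith
  · intro x X Y hX hY
    refine inner_ext g fun Z hZ ↦ ?_
    have h1 := hD X Z hX hY hZ
    have h2 := hD Y Z hY hX hZ
    change g.inner x (D Y x (X x) - D X x (Y x)) (Z x) = _
    have e : (fun y ↦ g.inner y (Y y) (X y)) = fun y ↦ g.inner y (X y) (Y y) := by
      ext y; exact g.symm y _ _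
    simp only [koszul, e, mlieBracket_swap_apply (V := Y) (W := X)] at h1 h2
    simp at h1 h2 ⊢
    linarith
/-- The Levi-Civita connection `∇` of the Riemannian metric `g`. -/
noncomputable def leviCivita : CovariantDerivative I E (TangentSpace I : M → Type _) :=
  (exists_isLeviCivita g).choose

theorem isLeviCivita_leviCivita : IsLeviCivita g (leviCivita g) :=
  (exists_isLeviCivita g).choose_spec

end LeviCivita

section Forms

variable {E : Type*} [NormedAddCommGroup E] [NormedSpace ℝ E]
  {H : Type*} [TopologicalSpace H] {I : ModelWithCorners ℝ E H}
  {M : Type*} [TopologicalSpace M] [ChartedSpace H M] [IsManifold I ∞ M]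

variable (I) in
/-- The vector field `X` is differentiable at `x`. -/
abbrev DiffFieldAt (X : Π x : M, TangentSpace I x) (x : M) : Prop :=
  MDifferentiableAt I I.tangent (fun y ↦ (⟨y, X y⟩ : TangentBundle I M)) x

/-- The exterior derivative of a 2-form `α`, evaluated on vector fields: `dα(X, Y, Z)` at `x`. -/
noncomputable def extDerivTwoForm (α : Π x : M, TangentSpace I x →L[ℝ] TangentSpace I x →L[ℝ] ℝ)
    (X Y Z : Π x : M, TangentSpace I x) (x : M) : ℝ :=
  mvfderiv I (fun y ↦ α y (Y y) (Z y)) x (X x)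
    + mvfderiv I (fun y ↦ α y (Z y) (X y)) x (Y x)
    + mvfderiv I (fun y ↦ α y (X y) (Y y)) x (Z x)
    - α x (mlieBracket I X Y x) (Z x)
    - α x (mlieBracket I Y Z x) (X x)
    - α x (mlieBracket I Z X x) (Y x)

/-- The 2-form `α` is closed on the set `U`. -/
def IsClosedTwoFormOn (U : Set M) (α : Π x : M, TangentSpace I x →L[ℝ] TangentSpace I x →L[ℝ] ℝ) :
    Prop :=
  ∀ x ∈ U, ∀ X Y Z : Π y : M, TangentSpace I y,
    DiffFieldAt I X x → DiffFieldAt I Y x → DiffFieldAt I Z x → extDerivTwoForm α X Y Z x = 0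

/-- The covariant derivative of a 1-form: `(∇_v θ)(Y) = v(θ(Y)) - θ(∇_v Y)` for `v ∈ T_x M`. -/
noncomputable def covDerivOneForm (cov : CovariantDerivative I E (TangentSpace I : M → Type _))
    (θ : Π x : M, TangentSpace I x →L[ℝ] ℝ) (Y : Π x : M, TangentSpace I x) (x : M)
    (v : TangentSpace I x) : ℝ :=
  mvfderiv I (fun y ↦ θ y (Y y)) x v - θ x (cov Y x v)

end Forms

section Complex

variable {E : Type*} [NormedAddCommGroup E] [NormedSpace ℂ E]
  {M : Type*} [TopologicalSpace M] [ChartedSpace E M]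

/-- A complex manifold is a smooth real manifold, with the same charts. -/
instance isManifold_real [IsManifold 𝓘(ℂ, E) ω M] : IsManifold 𝓘(ℝ, E) ∞ M := by
  refine isManifold_of_contDiffOn 𝓘(ℝ, E) ∞ M fun e e' he he' ↦ ?_
  have h := ((contDiffGroupoid ω 𝓘(ℂ, E)).compatible he he').1
  exact (h.restrict_scalars ℝ).of_le le_top

/-- The complex structure `J` of a complex manifold. The real tangent space `T_x M` is read in the
preferred holomorphic chart at `x`, where `J` is multiplication by `i`; the transition maps are
holomorphic, so `J` is multiplication by `i` in every holomorphic chart. -/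
noncomputable def complexStructure (x : M) :
    TangentSpace 𝓘(ℝ, E) x →L[ℝ] TangentSpace 𝓘(ℝ, E) x :=
  (Complex.I • ContinuousLinearMap.id ℝ E : E →L[ℝ] E)

/-- The fundamental form `Ω = h(J·, ·)` of a field of bilinear forms `h`. -/
noncomputable def fundamentalForm
    (h : Π x : M, TangentSpace 𝓘(ℝ, E) x →L[ℝ] TangentSpace 𝓘(ℝ, E) x →L[ℝ] ℝ) (x : M) :
    TangentSpace 𝓘(ℝ, E) x →L[ℝ] TangentSpace 𝓘(ℝ, E) x →L[ℝ] ℝ :=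
  h x ∘L complexStructure x

variable [IsManifold 𝓘(ℂ, E) ω M]

/-- `h` is a Kähler metric on the open set `U`: a smooth Riemannian metric there which is Hermitian
and whose fundamental form is closed. -/
structure IsKahlerOn (U : Set M)
    (h : Π x : M, TangentSpace 𝓘(ℝ, E) x →L[ℝ] TangentSpace 𝓘(ℝ, E) x →L[ℝ] ℝ) : Prop where
  symm : ∀ x ∈ U, ∀ u v, h x u v = h x v u
  pos : ∀ x ∈ U, ∀ u, u ≠ 0 → 0 < h x u u
  contMDiffOn : ContMDiffOn 𝓘(ℝ, E) (𝓘(ℝ, E).prod 𝓘(ℝ, E →L[ℝ] E →L[ℝ] ℝ)) ∞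
    (fun x ↦ TotalSpace.mk' (E →L[ℝ] E →L[ℝ] ℝ) x (h x)) U
  hermitian : ∀ x ∈ U, ∀ u v, h x (complexStructure x u) (complexStructure x v) = h x u v
  closed : IsClosedTwoFormOn U (fundamentalForm h)

/-- `(M, J, g)` is locally conformally Kähler with Lee form `θ`: the metric `g` is Hermitian, and
every point has an open neighbourhood `U` on which some conformal metric `e^{-f} g` is Kähler, where
`θ = df` on `U`. -/
structure IsLCK (g : ContMDiffRiemannianMetric 𝓘(ℝ, E) ∞ E (TangentSpace 𝓘(ℝ, E) : M → Type _))
    (θ : Π x : M, TangentSpace 𝓘(ℝ, E) x →L[ℝ] ℝ) : Prop where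
  hermitian : ∀ (x : M) (u v : TangentSpace 𝓘(ℝ, E) x),
    g.inner x (complexStructure x u) (complexStructure x v) = g.inner x u v
  conformally_kahler : ∀ x : M, ∃ U : Set M, IsOpen U ∧ x ∈ U ∧ ∃ f : M → ℝ,
    ContMDiffOn 𝓘(ℝ, E) 𝓘(ℝ) ∞ f U ∧
    IsKahlerOn U (fun y ↦ Real.exp (-f y) • g.inner y) ∧
    ∀ y ∈ U, θ y = mvfderiv 𝓘(ℝ, E) f y

variable [FiniteDimensional ℂ E]

/-- The (1,1)-part of `∇θ`, that is its `J`-invariant part: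
`(∇θ)^{1,1}(X, Y) = ½ ((∇_X θ)(Y) + (∇_{JX} θ)(JY))`. -/
noncomputable def nablaOneOne
    (g : ContMDiffRiemannianMetric 𝓘(ℝ, E) ∞ E (TangentSpace 𝓘(ℝ, E) : M → Type _))
    (θ : Π x : M, TangentSpace 𝓘(ℝ, E) x →L[ℝ] ℝ)
    (X Y : Π x : M, TangentSpace 𝓘(ℝ, E) x) (x : M) : ℝ :=
  (1 / 2) * (covDerivOneForm (leviCivita g) θ Y x (X x) +
    covDerivOneForm (leviCivita g) θ (fun y ↦ complexStructure y (Y y)) x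
      (complexStructure x (X x)))

/-- A pluricanonical lcK manifold with Lee form `θ`: an lcK manifold with `(∇θ)^{1,1} = 0`. -/
structure IsPluricanonical
    (g : ContMDiffRiemannianMetric 𝓘(ℝ, E) ∞ E (TangentSpace 𝓘(ℝ, E) : M → Type _))
    (θ : Π x : M, TangentSpace 𝓘(ℝ, E) x →L[ℝ] ℝ) : Prop where
  isLCK : IsLCK g θ
  nabla_one_one : ∀ (x : M) (X Y : Π y : M, TangentSpace 𝓘(ℝ, E) y),
    DiffFieldAt 𝓘(ℝ, E) X x → DiffFieldAt 𝓘(ℝ, E) Y x → nablaOneOne g θ X Y x = 0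

/-- A Vaisman manifold with Lee form `θ`: an lcK manifold with `∇θ = 0`. -/
structure IsVaisman
    (g : ContMDiffRiemannianMetric 𝓘(ℝ, E) ∞ E (TangentSpace 𝓘(ℝ, E) : M → Type _))
    (θ : Π x : M, TangentSpace 𝓘(ℝ, E) x →L[ℝ] ℝ) : Prop where
  isLCK : IsLCK g θ
  parallel : ∀ (x : M) (v : TangentSpace 𝓘(ℝ, E) x) (Y : Π y : M, TangentSpace 𝓘(ℝ, E) y),
    DiffFieldAt 𝓘(ℝ, E) Y x → covDerivOneForm (leviCivita g) θ Y x v = 0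

end Complex

end LCK

/-!
The statement follows from the maximum principle for `|∇θ|²`, applied along the complex curves
tangent to the Lee vector field `T`, `θ = g(T, ·)`.

In a holomorphic chart, `J` is constant. Let `Ω = g(J·, ·)`. Since `θ` is closed, `∇θ` is half of the
Lie derivative of `g` along `T`. If `(∇θ)^{1,1} = 0`, a comparison of `J`-types in Cartan's formula
for the Lie derivative of `Ω` along `T` shows two things: `∇T` is the antilinear part `S = ∂̄T` of
the flat derivative of `T` (`IsFlatPluricanonical.flatCovDeriv_eq`), so that no connection is needed
any more, and `d(Jθ) = |θ|² Ω + θ ∧ Jθ`. Differentiating the latter gives `d|θ|² ∧ Ω = 0`, hence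
`|θ|` is locally constant in complex dimension at least `2`
(`IsFlatPluricanonical.fderiv_sq_norm_eq_zero`), which means `S T = 0`.

The identity `S T = 0` alone, differentiated twice, shows that `S` is holomorphic along the complex
curves tangent to `T`, up to a linear term, and that for `u = tr S²` the second derivatives satisfy
`D²u(T, T) + D²u(JT, JT) = 4 tr C² + 8 tr S⁴`, where `C` is the Lie derivative of `S` along `T`
(`laplacian_trace_sq`). Both `S` and `C` are self-adjoint for `g`, so the right-hand side is
nonnegative, and at a local maximum of `u` it must vanish, which gives `S = 0` there
(`IsFlatPluricanonical.antilinearDeriv_eq_zero`).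

On the compact manifold `M`, the function `tr (∇T)²` is globally defined and equals `u` in every
chart, so it attains its maximum, and the maximum is `0`. As `∇T` is self-adjoint, `∇T = 0`.
-/

namespace LCK

/-! ### Traces of self-adjoint endomorphisms -/

section Trace

variable {E : Type*} [NormedAddCommGroup E] [NormedSpace ℝ E]

/-- `b` is a (Euclidean) scalar product. -/
structure IsScalarProduct (b : E →L[ℝ] E →L[ℝ] ℝ) : Prop where
  symm : ∀ u v, b u v = b v u
  pos : ∀ u, u ≠ 0 → 0 < b u u

theorem IsScalarProduct.eq_zero {b : E →L[ℝ] E →L[ℝ] ℝ} (hb : IsScalarProduct b) {u : E}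
    (h : b u u = 0) : u = 0 := by
  by_contra hu
  exact (hb.pos u hu).ne' h

theorem IsScalarProduct.ext {b : E →L[ℝ] E →L[ℝ] ℝ} (hb : IsScalarProduct b) {u v : E}
    (h : ∀ w, b u w = b v w) : u = v := by
  refine sub_eq_zero.1 (hb.eq_zero ?_)
  simp [h]

/-- The trace of a continuous endomorphism, as a continuous linear form. -/
noncomputable def traceCLM (E : Type*) [NormedAddCommGroup E] [NormedSpace ℝ E]
    [FiniteDimensional ℝ E] : (E →L[ℝ] E) →L[ℝ] ℝ :=
  LinearMap.toContinuousLinearMap (LinearMap.trace ℝ E ∘ₗ ContinuousLinearMap.coeLM ℝ)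

variable [FiniteDimensional ℝ E]

theorem traceCLM_apply (A : E →L[ℝ] E) :
    traceCLM E A = LinearMap.trace ℝ E (A : E →ₗ[ℝ] E) := rfl

theorem traceCLM_mul_comm (A B : E →L[ℝ] E) : traceCLM E (A * B) = traceCLM E (B * A) :=
  LinearMap.trace_mul_comm ℝ (A : E →ₗ[ℝ] E) (B : E →ₗ[ℝ] E)

/-- A self-adjoint endomorphism `A` of a Euclidean space has `tr A² ≥ 0`, with equality only for
`A = 0`. -/
theorem trace_sq_of_isSymmetric {F : Type*} [NormedAddCommGroup F] [InnerProductSpace ℝ F]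
    [FiniteDimensional ℝ F] {A : F →ₗ[ℝ] F} (hA : A.IsSymmetric) :
    0 ≤ LinearMap.trace ℝ F (A * A) ∧ (LinearMap.trace ℝ F (A * A) = 0 → A = 0) := by
  have h : LinearMap.trace ℝ F (A * A) = ∑ i, ‖A (stdOrthonormalBasis ℝ F i)‖ ^ 2 := by
    rw [LinearMap.trace_eq_sum_inner _ (stdOrthonormalBasis ℝ F)]
    refine Finset.sum_congr rfl fun i _ ↦ ?_
    rw [Module.End.mul_apply, ← hA, real_inner_self_eq_norm_sq]
  rw [h]
  refine ⟨by positivity, fun h0 ↦ (stdOrthonormalBasis ℝ F).toBasis.ext fun i ↦ ?_⟩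
  have := (Finset.sum_eq_zero_iff_of_nonneg (fun _ _ ↦ by positivity)).1 h0 i (Finset.mem_univ i)
  simpa using this

theorem IsScalarProduct.trace_sq {b : E →L[ℝ] E →L[ℝ] ℝ} (hb : IsScalarProduct b)
    {A : E →L[ℝ] E} (hA : ∀ u v, b (A u) v = b u (A v)) :
    0 ≤ traceCLM E (A * A) ∧ (traceCLM E (A * A) = 0 → A = 0) := by
  have key : ∀ (V : Type _) [AddCommGroup V] [Module ℝ V] [Module.Finite ℝ V]
      (B : V →ₗ[ℝ] V →ₗ[ℝ] ℝ) (_ : ∀ u v, B u v = B v u) (_ : ∀ u, u ≠ 0 → 0 < B u u)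
      (A : V →ₗ[ℝ] V) (_ : ∀ u v, B (A u) v = B u (A v)),
      0 ≤ LinearMap.trace ℝ V (A * A) ∧ (LinearMap.trace ℝ V (A * A) = 0 → A = 0) := by
    intro V _ _ _ B hs hp A hA
    let c : InnerProductSpace.Core ℝ V :=
      { inner := fun u v ↦ B u v
        conj_inner_symm := fun u v ↦ hs v u
        re_inner_nonneg := fun u ↦ by
          by_cases hu : u = 0
          · simp [hu]
          · exact (hp u hu).le
        add_left := by intros; simp
        smul_left := by intros; simp
        definite := fun u hu ↦ by
          by_contra hne
          exact (hp u hne).ne' hu }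
    let _ : NormedAddCommGroup V := c.toNormedAddCommGroup
    let _ : InnerProductSpace ℝ V := InnerProductSpace.ofCore c.toCore
    exact trace_sq_of_isSymmetric (A := A) hA
  obtain ⟨h1, h2⟩ := key E ((ContinuousLinearMap.coeLM ℝ).comp (b : E →ₗ[ℝ] E →L[ℝ] ℝ)) hb.symm
    hb.pos (A : E →ₗ[ℝ] E) hA
  exact ⟨h1, fun h ↦ ContinuousLinearMap.coe_injective (h2 h)⟩

theorem IsScalarProduct.isInvertible {b : E →L[ℝ] E →L[ℝ] ℝ} (hb : IsScalarProduct b) :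
    b.IsInvertible := by
  have hinj : Function.Injective (b : E →ₗ[ℝ] E →L[ℝ] ℝ) := fun u v h ↦
    hb.ext fun w ↦ congr($h w)
  have hfr : Module.finrank ℝ E = Module.finrank ℝ (E →L[ℝ] ℝ) := by
    rw [← (LinearMap.toContinuousLinearMap (𝕜 := ℝ) (E := E) (F' := ℝ)).finrank_eq]
    exact (Subspace.dual_finrank_eq (K := ℝ) (V := E)).symm
  let e := LinearEquiv.ofInjectiveOfFinrankEq _ hinj hfr
  exact ⟨e.toContinuousLinearEquiv, by ext; rfl⟩

/-- Wedge product with a nondegenerate `2`-form is injective on `1`-forms in real dimension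
greater than `2`. -/
theorem IsScalarProduct.eq_zero_of_wedge {b : E →L[ℝ] E →L[ℝ] ℝ} (hb : IsScalarProduct b)
    {J : E →L[ℝ] E} (hJ : ∀ v, J (J v) = -v) (hherm : ∀ u v, b (J u) (J v) = b u v)
    (hdim : 2 < Module.finrank ℝ E) {α : E → ℝ}
    (h : ∀ X Y Z, α X * b (J Y) Z + α Y * b (J Z) X + α Z * b (J X) Y = 0) (X : E) : α X = 0 := by
  let ψ : E →ₗ[ℝ] ℝ × ℝ := ((b X).prod (b (J X)) : E →L[ℝ] ℝ × ℝ)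
  -- a nonzero `Y` orthogonal to `X` and `JX`
  obtain ⟨Y, hY, hY0⟩ := (Submodule.ne_bot_iff _).1
    (LinearMap.ker_ne_bot_of_finrank_lt (f := ψ) (by simpa using hdim))
  have h1 : b X Y = 0 := congr(($hY).1)
  have h2 : b (J X) Y = 0 := congr(($hY).2)
  have h3 := h X Y (J Y)
  have h5 : b (-Y) X = 0 := by rw [hb.symm, map_neg, h1, neg_zero]
  rw [hherm, hJ, h2, h5] at h3
  have := hb.pos Y hY0
  have h4 : α X * b Y Y = 0 := by linarith
  exact (mul_eq_zero.1 h4).resolve_right this.ne'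

end Trace

/-! ### Calculus -/

section Calculus

variable {E : Type*} [NormedAddCommGroup E] [NormedSpace ℝ E]

/-- The second derivative of a function is negative semidefinite at a local maximum. -/
theorem fderiv_fderiv_nonpos_of_isLocalMax {u : E → ℝ} {x : E} (hu : ContDiffAt ℝ 2 u x)
    (hmax : IsLocalMax u x) (v : E) : fderiv ℝ (fderiv ℝ u) x v v ≤ 0 := by
  by_contra! hpos
  let c : ℝ → E := fun t ↦ x + t • v
  have hc : ∀ t, HasDerivAt c v t := fun t ↦ by
    have := ((hasDerivAt_id t).smul_const v).const_add x
    rwa [one_smul] at this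
  have hc0 : c 0 = x := by simp [c]
  have hcont : ContinuousAt c 0 := (hc 0).continuousAt
  have hev : ∀ᶠ t in nhds 0, ContDiffAt ℝ 2 u (c t) :=
    hcont.eventually (by rw [hc0]; exact hu.eventually (by simp))
  have hd : ∀ᶠ t in nhds 0, deriv (u ∘ c) t = fderiv ℝ u (c t) v := by
    filter_upwards [hev] with t ht
    exact ((ht.differentiableAt (by simp)).hasFDerivAt.comp_hasDerivAt t (hc t)).deriv
  have hdd : deriv (deriv (u ∘ c)) 0 = fderiv ℝ (fderiv ℝ u) x v v := by
    rw [Filter.EventuallyEq.deriv_eq hd]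
    have h2 : HasFDerivAt (fderiv ℝ u) (fderiv ℝ (fderiv ℝ u) x) (c 0) := by
      rw [hc0]
      exact ((hu.fderiv_right (m := 1) (by norm_num)).differentiableAt (by simp)).hasFDerivAt
    exact ((h2.comp_hasDerivAt 0 (hc 0)).clm_apply (hasDerivAt_const 0 v)).deriv.trans (by simp)
  have hmax' : IsLocalMax (u ∘ c) 0 := by
    have : IsLocalMax u (c 0) := by rwa [hc0]
    exact this.comp_continuous hcont
  have hmin : IsLocalMin (u ∘ c) 0 := by
    refine isLocalMin_of_deriv_deriv_pos (by rwa [hdd]) hmax'.deriv_eq_zero ?_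
    exact (hev.self_of_nhds.continuousAt).comp hcont
  -- a function with a local minimum and a local maximum at `0` is locally constant
  have hconst : (u ∘ c) =ᶠ[nhds 0] fun _ ↦ (u ∘ c) 0 := by
    filter_upwards [hmax', hmin] with t h1 h2 using le_antisymm h1 h2
  have : deriv (deriv (u ∘ c)) 0 = 0 := by
    rw [Filter.EventuallyEq.deriv_eq hconst.deriv]
    simp
  linarith

theorem fderiv_clm_apply_const₂ {g : E → E →L[ℝ] E →L[ℝ] ℝ} {x : E}
    (hg : DifferentiableAt ℝ g x) (Y Z X : E) :
    fderiv ℝ (fun y ↦ g y Y Z) x X = fderiv ℝ g x X Y Z := by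
  have := (hg.hasFDerivAt.clm_apply (hasFDerivAt_const Y x)).clm_apply (hasFDerivAt_const Z x)
  rw [this.fderiv]
  simp

end Calculus

/-! ### The antilinear part of the derivative of a vector field -/

section Flat

variable {E : Type*} [NormedAddCommGroup E] [NormedSpace ℝ E]

theorem hasFDerivAt_fderiv {F : Type*} [NormedAddCommGroup F] [NormedSpace ℝ F] {f : E → F} {x : E}
    (hf : ContDiffAt ℝ ∞ f x) : HasFDerivAt (fderiv ℝ f) (fderiv ℝ (fderiv ℝ f) x) x :=
  ((hf.fderiv_right (m := ∞) (by simp)).differentiableAt (by simp)).hasFDerivAt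

/-- The `J`-antilinear part `½ (D T + J ∘ D T ∘ J)` of the derivative of the vector field `T`; for a
constant complex structure `J` this is `∂̄T`. -/
noncomputable def antilinearDeriv (J : E →L[ℝ] E) (T : E → E) (x : E) : E →L[ℝ] E :=
  (1 / 2 : ℝ) • (fderiv ℝ T x + J * fderiv ℝ T x * J)

theorem antilinearDeriv_mul {J : E →L[ℝ] E} (hJ : J * J = -1) (T : E → E) (x : E) :
    antilinearDeriv J T x * J = -(J * antilinearDeriv J T x) := by
  simp only [antilinearDeriv, smul_mul_assoc, mul_smul_comm, mul_add, add_mul, mul_assoc, hJ]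
  rw [← mul_assoc J J, hJ]
  simp [← smul_neg]

variable {J : E →L[ℝ] E} {U : Set E} {T : E → E}

theorem contDiffOn_antilinearDeriv (hU : IsOpen U) (hT : ContDiffOn ℝ ∞ T U) :
    ContDiffOn ℝ ∞ (antilinearDeriv J T) U := by
  have h := hT.fderiv_of_isOpen hU (m := ∞) (by simp)
  exact (h.add ((contDiffOn_const.clm_comp h).clm_comp contDiffOn_const)).const_smul _

theorem fderiv_antilinearDeriv_apply {x : E} (hT : ContDiffAt ℝ ∞ T x) (v w : E) :
    fderiv ℝ (antilinearDeriv J T) x v w = (1 / 2 : ℝ) • (fderiv ℝ (fderiv ℝ T) x v w +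
      J (fderiv ℝ (fderiv ℝ T) x v (J w))) := by
  have h := hasFDerivAt_fderiv hT
  have h2 := ((h.add (((hasFDerivAt_const J x).clm_comp h).clm_comp
    (hasFDerivAt_const J x))).const_smul (1 / 2 : ℝ))
  have h3 : fderiv ℝ (antilinearDeriv J T) x = _ := h2.fderiv
  rw [h3]
  simp

theorem fderiv_antilinearDeriv_mul (hJ : J * J = -1) {x : E} (hT : ContDiffAt ℝ ∞ T x) (v : E) :
    fderiv ℝ (antilinearDeriv J T) x v * J = -(J * fderiv ℝ (antilinearDeriv J T) x v) := by
  ext w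
  have hJ' : ∀ v, J (J v) = -v := fun v ↦ congr($hJ v)
  change fderiv ℝ (antilinearDeriv J T) x v (J w) = -J (fderiv ℝ (antilinearDeriv J T) x v w)
  simp only [fderiv_antilinearDeriv_apply hT, hJ', map_smul, map_add, map_neg]
  module

theorem mul_clm_apply (A B : E →L[ℝ] E) (v : E) : (A * B) v = A (B v) := rfl

theorem hasFDerivAt_mul_clm {A B : E → E →L[ℝ] E} {A' B' : E →L[ℝ] E →L[ℝ] E} {x : E}
    (hA : HasFDerivAt A A' x) (hB : HasFDerivAt B B' x) :
    ∃ C : E →L[ℝ] E →L[ℝ] E, HasFDerivAt (fun y ↦ A y * B y) C x ∧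
      ∀ v, C v = A' v * B x + A x * B' v := by
  refine ⟨_, hA.clm_comp hB, fun v ↦ ?_⟩
  simp [add_comm, ContinuousLinearMap.mul_def]

/-- The derivative of the identity `∂̄T(T) = 0`. -/
theorem fderiv_antilinearDeriv_self (hU : IsOpen U) (hT : ContDiffOn ℝ ∞ T U)
    (hST : ∀ x ∈ U, antilinearDeriv J T x (T x) = 0) {x : E} (hx : x ∈ U) (v : E) :
    fderiv ℝ (antilinearDeriv J T) x v (T x) = -antilinearDeriv J T x (fderiv ℝ T x v) := by
  have hS := ((contDiffOn_antilinearDeriv (J := J) hU hT).contDiffAt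
    (hU.mem_nhds hx)).differentiableAt (by simp)
  have hT' := (hT.contDiffAt (hU.mem_nhds hx)).differentiableAt (by simp)
  have h0 : (fun y ↦ antilinearDeriv J T y (T y)) =ᶠ[nhds x] fun _ ↦ 0 := by
    filter_upwards [hU.mem_nhds hx] with y hy using hST y hy
  have h1 := (hS.hasFDerivAt.clm_apply hT'.hasFDerivAt).fderiv
  rw [h0.fderiv_eq] at h1
  have h2 := congr($h1 v)
  simp only [fderiv_fun_const, Pi.zero_apply, zero_apply, add_apply,
    ContinuousLinearMap.comp_apply, ContinuousLinearMap.flip_apply] at h2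
  rw [eq_neg_iff_add_eq_zero, h2, add_comm]

theorem fderiv_fderiv_comm {F : Type*} [NormedAddCommGroup F] [NormedSpace ℝ F] {f : E → F}
    {x : E} (hf : ContDiffAt ℝ ∞ f x) (v w : E) :
    fderiv ℝ (fderiv ℝ f) x v w = fderiv ℝ (fderiv ℝ f) x w v :=
  (hf.isSymmSndFDerivAt (by simpa using WithTop.coe_le_coe.2 (le_top (a := (2 : ℕ∞))))).eq v w

/-- If `∂̄T` annihilates `T`, then `∂̄T` is holomorphic along the complex curves tangent to `T`, up to
a term that is linear in `∂̄T`. -/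
theorem dbar_antilinearDeriv (hU : IsOpen U) (hJ : J * J = -1) (hT : ContDiffOn ℝ ∞ T U)
    (hST : ∀ x ∈ U, antilinearDeriv J T x (T x) = 0) {x : E} (hx : x ∈ U) :
    fderiv ℝ (antilinearDeriv J T) x (T x) + J * fderiv ℝ (antilinearDeriv J T) x (J (T x)) =
      -(2 : ℝ) • (antilinearDeriv J T x * (fderiv ℝ T x - antilinearDeriv J T x)) := by
  ext X
  have hT' := hT.contDiffAt (hU.mem_nhds hx)
  have hJ' : ∀ v, J (J v) = -v := fun v ↦ congr($hJ v)
  have hSJ : ∀ v, antilinearDeriv J T x (J v) = -J (antilinearDeriv J T x v) := fun v ↦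
    congr($(antilinearDeriv_mul hJ T x) v)
  have hS : antilinearDeriv J T x X =
      (1 / 2 : ℝ) • (fderiv ℝ T x X + J (fderiv ℝ T x (J X))) := rfl
  have hS' := congr(antilinearDeriv J T x $hS)
  have h1 := fderiv_antilinearDeriv_self hU hT hST hx X
  have h2 := congr(J $(fderiv_antilinearDeriv_self hU hT hST hx (J X)))
  rw [fderiv_antilinearDeriv_apply hT'] at h1 h2
  simp only [add_apply, mul_clm_apply, fderiv_antilinearDeriv_apply hT',
    smul_apply, sub_apply, map_smul, map_add, map_sub, map_neg,
    hJ', hSJ, fderiv_fderiv_comm hT' X, fderiv_fderiv_comm hT' (J X)] at h1 h2 hS' ⊢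
  linear_combination (norm := module) h1 + h2 - (2 : ℝ) • hS'

/-- The counterpart of `dbar_antilinearDeriv` for the linear part of the derivative of `T`. This is
where a definite sign appears: geometrically, the curvature of the local Kähler metrics along the
complex curves tangent to `T` is a multiple of `J (∂̄T)²`. -/
theorem dbar_linearDeriv (hU : IsOpen U) (hJ : J * J = -1) (hT : ContDiffOn ℝ ∞ T U)
    (hST : ∀ x ∈ U, antilinearDeriv J T x (T x) = 0) {x : E} (hx : x ∈ U) :
    (fderiv ℝ (fderiv ℝ T) x (T x) - fderiv ℝ (antilinearDeriv J T) x (T x)) +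
      J * (fderiv ℝ (fderiv ℝ T) x (J (T x)) - fderiv ℝ (antilinearDeriv J T) x (J (T x))) =
      -(2 : ℝ) • (antilinearDeriv J T x * antilinearDeriv J T x) := by
  ext X
  have hT' := hT.contDiffAt (hU.mem_nhds hx)
  have hJ' : ∀ v, J (J v) = -v := fun v ↦ congr($hJ v)
  have hSJ : ∀ v, antilinearDeriv J T x (J v) = -J (antilinearDeriv J T x v) := fun v ↦
    congr($(antilinearDeriv_mul hJ T x) v)
  have hS : antilinearDeriv J T x X =
      (1 / 2 : ℝ) • (fderiv ℝ T x X + J (fderiv ℝ T x (J X))) := rfl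
  have hS' := congr(antilinearDeriv J T x $hS)
  have h1 := fderiv_antilinearDeriv_self hU hT hST hx X
  have h2 := congr(J $(fderiv_antilinearDeriv_self hU hT hST hx (J X)))
  rw [fderiv_antilinearDeriv_apply hT'] at h1 h2
  simp only [add_apply, mul_clm_apply, fderiv_antilinearDeriv_apply hT',
    smul_apply, sub_apply, map_smul, map_add, map_sub, map_neg,
    hJ', hSJ, fderiv_fderiv_comm hT' X, fderiv_fderiv_comm hT' (J X)] at h1 h2 hS' ⊢
  linear_combination (norm := module) h1 - h2 + (2 : ℝ) • hS'

theorem fderiv_fderiv_trace_sq [FiniteDimensional ℝ E] {S : E → E →L[ℝ] E} (hU : IsOpen U)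
    (hS : ContDiffOn ℝ ∞ S U) {x : E} (hx : x ∈ U) (v : E) :
    fderiv ℝ (fderiv ℝ fun y ↦ traceCLM E (S y * S y)) x v v =
      2 * traceCLM E (fderiv ℝ S x v * fderiv ℝ S x v) +
      2 * traceCLM E (S x * fderiv ℝ (fderiv ℝ S) x v v) := by
  have hd : ∀ y ∈ U, HasFDerivAt S (fderiv ℝ S y) y := fun y hy ↦
    ((hS.contDiffAt (hU.mem_nhds hy)).differentiableAt (by simp)).hasFDerivAt
  have h1 : ∀ y ∈ U, ∀ w, fderiv ℝ (fun y ↦ traceCLM E (S y * S y)) y w =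
      2 * traceCLM E (S y * fderiv ℝ S y w) := by
    intro y hy w
    obtain ⟨C, hC, hCv⟩ := hasFDerivAt_mul_clm (hd y hy) (hd y hy)
    have h : HasFDerivAt (fun y ↦ traceCLM E (S y * S y)) ((traceCLM E).comp C) y :=
      (traceCLM E).hasFDerivAt.comp y hC
    rw [h.fderiv, ContinuousLinearMap.comp_apply, hCv, map_add, traceCLM_mul_comm]
    ring
  have h2 : ContDiffOn ℝ ∞ (fun y ↦ traceCLM E (S y * S y)) U :=
    (traceCLM E).contDiff.comp_contDiffOn (hS.clm_comp hS)
  have h3 := hasFDerivAt_fderiv (h2.contDiffAt (hU.mem_nhds hx))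
  have h4 : fderiv ℝ (fun y ↦ fderiv ℝ (fun y ↦ traceCLM E (S y * S y)) y v) x v =
      fderiv ℝ (fderiv ℝ fun y ↦ traceCLM E (S y * S y)) x v v := by
    rw [(h3.clm_apply (hasFDerivAt_const v x)).fderiv]
    simp
  have h5 : (fun y ↦ fderiv ℝ (fun y ↦ traceCLM E (S y * S y)) y v) =ᶠ[nhds x]
      fun y ↦ 2 * traceCLM E (S y * fderiv ℝ S y v) := by
    filter_upwards [hU.mem_nhds hx] with y hy using h1 y hy v
  have h6 := hasFDerivAt_fderiv (hS.contDiffAt (hU.mem_nhds hx))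
  obtain ⟨C, hC, hCv⟩ := hasFDerivAt_mul_clm (hd x hx) (h6.clm_apply (hasFDerivAt_const v x))
  have h7 : HasFDerivAt (fun y ↦ 2 * traceCLM E (S y * fderiv ℝ S y v))
      ((2 : ℝ) • (traceCLM E).comp C) x := ((traceCLM E).hasFDerivAt.comp x hC).const_mul 2
  rw [← h4, h5.fderiv_eq, h7.fderiv, smul_apply,
    ContinuousLinearMap.comp_apply, hCv, map_add, add_apply, ContinuousLinearMap.comp_apply,
    zero_apply, map_zero, ContinuousLinearMap.flip_apply, smul_eq_mul, mul_add]
  erw [zero_add]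

/-- The Laplacian of `tr (∂̄T)²` along the complex curves tangent to `T`, at a point: both terms on
the right are nonnegative as soon as `∂̄T` and its Lie derivative `C` along `T` are self-adjoint for
some scalar product. -/
theorem laplacian_trace_sq [FiniteDimensional ℝ E] (hU : IsOpen U) (hJ : J * J = -1)
    (hT : ContDiffOn ℝ ∞ T U) (hST : ∀ x ∈ U, antilinearDeriv J T x (T x) = 0)
    {x : E} (hx : x ∈ U) {S C : E →L[ℝ] E} (hS : S = antilinearDeriv J T x)
    (hC : C = fderiv ℝ (antilinearDeriv J T) x (T x) + S * fderiv ℝ T x - fderiv ℝ T x * S) :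
    fderiv ℝ (fderiv ℝ fun y ↦ traceCLM E (antilinearDeriv J T y * antilinearDeriv J T y)) x
        (T x) (T x) +
      fderiv ℝ (fderiv ℝ fun y ↦ traceCLM E (antilinearDeriv J T y * antilinearDeriv J T y)) x
        (J (T x)) (J (T x)) =
      4 * traceCLM E (C * C) + 8 * traceCLM E ((S * S) * (S * S)) := by
  have hSm := contDiffOn_antilinearDeriv (J := J) hU hT
  have hSx := hSm.contDiffAt (hU.mem_nhds hx)
  have hTx : HasFDerivAt T (fderiv ℝ T x) x :=
    ((hT.contDiffAt (hU.mem_nhds hx)).differentiableAt (by simp)).hasFDerivAt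
  have hDx := hasFDerivAt_fderiv (hT.contDiffAt (hU.mem_nhds hx))
  have hS1 : HasFDerivAt (antilinearDeriv J T) (fderiv ℝ (antilinearDeriv J T) x) x :=
    (hSx.differentiableAt (by simp)).hasFDerivAt
  have hS2 := hasFDerivAt_fderiv hSx
  have e1 := dbar_antilinearDeriv hU hJ hT hST hx
  have e2 := dbar_linearDeriv hU hJ hT hST hx
  -- the derivative of `dbar_antilinearDeriv` in the direction `v`
  have e3 : ∀ v, fderiv ℝ (fderiv ℝ (antilinearDeriv J T)) x v (T x) +
      fderiv ℝ (antilinearDeriv J T) x (fderiv ℝ T x v) +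
      J * (fderiv ℝ (fderiv ℝ (antilinearDeriv J T)) x v (J (T x)) +
      fderiv ℝ (antilinearDeriv J T) x (J (fderiv ℝ T x v))) =
      -(2 : ℝ) • (fderiv ℝ (antilinearDeriv J T) x v *
          (fderiv ℝ T x - antilinearDeriv J T x) +
        antilinearDeriv J T x *
          (fderiv ℝ (fderiv ℝ T) x v - fderiv ℝ (antilinearDeriv J T) x v)) := by
    intro v
    have h1 := hS2.clm_apply hTx
    obtain ⟨C1, hC1, hC1v⟩ := hasFDerivAt_mul_clm (hasFDerivAt_const J x)
      (hS2.clm_apply (J.hasFDerivAt.comp x hTx))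
    obtain ⟨C2, hC2, hC2v⟩ := hasFDerivAt_mul_clm hS1 (hDx.sub hS1)
    have h0 : (fun y ↦ fderiv ℝ (antilinearDeriv J T) y (T y) +
        J * fderiv ℝ (antilinearDeriv J T) y (J (T y))) =ᶠ[nhds x]
        fun y ↦ -(2 : ℝ) • (antilinearDeriv J T y * (fderiv ℝ T y - antilinearDeriv J T y)) := by
      filter_upwards [hU.mem_nhds hx] with y hy using dbar_antilinearDeriv hU hJ hT hST hy
    have h2 := (h1.add hC1).fderiv.symm.trans
      (h0.fderiv_eq.trans (hC2.const_smul (-(2 : ℝ))).fderiv)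
    have h3 := congr($h2 v)
    simp only [add_apply, hC1v, smul_apply, hC2v, ContinuousLinearMap.comp_apply,
      ContinuousLinearMap.flip_apply, zero_apply, zero_mul, zero_add, sub_apply,
      Pi.sub_apply, Function.comp_apply] at h3
    rw [← h3]
    simp only [mul_add]
    abel
  have hST' := hST x hx
  have hTT : fderiv ℝ T x (J (T x)) = J (fderiv ℝ T x (T x)) := by
    have h1 : (1 / 2 : ℝ) • (fderiv ℝ T x (T x) + J (fderiv ℝ T x (J (T x)))) = 0 := hST'
    have h2 := congr(J $((smul_eq_zero.1 h1).resolve_left (by norm_num)))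
    have hJ' : ∀ v, J (J v) = -v := fun v ↦ congr($hJ v)
    simp only [map_add, hJ', map_zero] at h2
    linear_combination (norm := module) -h2
  -- adding `e3` in the direction `T` to `-J` times `e3` in the direction `JT`, the mixed second
  -- derivatives cancel
  have e4 := e3 (T x)
  have e5 := congr(J * $(e3 (J (T x))))
  rw [hTT] at e5
  rw [fderiv_fderiv_trace_sq hU hSm hx, fderiv_fderiv_trace_sq hU hSm hx]
  rw [fderiv_fderiv_comm hSx (J (T x)) (T x)] at e5
  have hJ' : ∀ v, J (J v) = -v := fun v ↦ congr($hJ v)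
  simp only [hJ', map_neg] at e5
  have hSJ : S * J = -(J * S) := hS ▸ antilinearDeriv_mul hJ T x
  have hbJ := fderiv_antilinearDeriv_mul hJ (hT.contDiffAt (hU.mem_nhds hx)) (J (T x))
  rw [← hS] at *
  generalize fderiv ℝ (antilinearDeriv J T) x (T x) = a at *
  generalize fderiv ℝ (antilinearDeriv J T) x (J (T x)) = b at *
  generalize fderiv ℝ (antilinearDeriv J T) x (fderiv ℝ T x (T x)) = w at *
  generalize fderiv ℝ (antilinearDeriv J T) x (J (fderiv ℝ T x (T x))) = w' at *
  generalize fderiv ℝ (fderiv ℝ (antilinearDeriv J T)) x (T x) (T x) = p at *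
  generalize fderiv ℝ (fderiv ℝ (antilinearDeriv J T)) x (J (T x)) (J (T x)) = q at *
  generalize fderiv ℝ (fderiv ℝ (antilinearDeriv J T)) x (T x) (J (T x)) = r at *
  generalize fderiv ℝ (fderiv ℝ T) x (T x) = l at *
  generalize fderiv ℝ (fderiv ℝ T) x (J (T x)) = m at *
  generalize fderiv ℝ T x = D at *
  clear e3 hTT hST' hS2 hS1 hDx hTx hSx hSm hST hT hJ' hS
  simp only [neg_smul, two_smul] at e1 e2 e4 e5
  -- `L` is the linear part of the derivative of `T`
  obtain ⟨L, rfl⟩ : ∃ L, D = L + S := ⟨D - S, by abel⟩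
  simp only [add_sub_cancel_right] at e1 e2 e4 e5
  have hJJ : ∀ A : E →L[ℝ] E, J * (J * A) = -A := fun A ↦ by rw [← mul_assoc, hJ, neg_one_mul]
  have hSJ' : ∀ A : E →L[ℝ] E, S * (J * A) = -(J * (S * A)) := fun A ↦ by
    rw [← mul_assoc, hSJ, neg_mul, mul_assoc]
  have hJb : J * b = -(a + S * L + S * L) := by
    linear_combination (norm := noncomm_ring) e1
  have hb : traceCLM E (b * b) = traceCLM E ((a + S * L + S * L) * (a + S * L + S * L)) := by
    have h1 : (a + S * L + S * L) * (a + S * L + S * L) = b * b := by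
      rw [← neg_mul_neg, ← hJb, mul_assoc, ← mul_assoc b, hbJ, neg_mul, mul_neg, mul_assoc, hJJ,
        neg_neg]
    rw [h1]
  have e6 := congr(S * $e2)
  have e7 := congr($hJb * L)
  have hpq : p + q = -((4 : ℕ) • ((a + S * L) * L)) + (4 : ℕ) • (S * (S * S)) := by
    simp only [mul_add, mul_sub, mul_neg, hJJ, hSJ', mul_assoc] at e4 e5 e6 e7
    linear_combination (norm := noncomm_ring) e4 - e5 + e7 + e7 - e6 - e6
  have hpq' := congr(traceCLM E (S * $hpq))
  have hC' : C = a + S * L - L * S := by rw [hC]; noncomm_ring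
  have c2 := traceCLM_mul_comm (a * L) S
  have c3 := traceCLM_mul_comm L (S * a)
  have c4 := traceCLM_mul_comm (S * L * L) S
  have c5 := traceCLM_mul_comm L (S * S * L)
  have c6 := traceCLM_mul_comm L (S * L * S)
  rw [hC', hb]
  clear hb hC hC' hJb e1 e2 e4 e5 e6 e7 hJJ hSJ' hpq hSJ hbJ hJ
  simp only [mul_add, add_mul, mul_sub, sub_mul, map_add, map_sub, mul_assoc, map_neg, mul_neg,
    map_nsmul, mul_smul_comm] at *
  linear_combination 2 * hpq' + 4 * c2 + 4 * c3 + 4 * c4 + 4 * c5 - 4 * c6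

end Flat

/-! ### Pluricanonical structures in flat coordinates -/

section FlatPluricanonical

variable {E : Type*} [NormedAddCommGroup E] [NormedSpace ℝ E]

/-- The covariant derivative `(∇_X θ)(Y) = X(θ(Y)) - g(t, ∇_X Y)` at `x` of the `1`-form `θ`, where
`θ_x = g(t, ·)` and `X`, `Y` are constant vector fields, so that `g(t, ∇_X Y)` is given by the
Christoffel symbols of the metric `g`. -/
noncomputable def flatCovDeriv (g : E → E →L[ℝ] E →L[ℝ] ℝ) (θ : E → E →L[ℝ] ℝ) (x t X Y : E) : ℝ :=
  fderiv ℝ θ x X Y -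
    (1 / 2) * (fderiv ℝ g x X Y t + fderiv ℝ g x Y X t - fderiv ℝ g x t X Y)

/-- The data of a pluricanonical lcK structure in a holomorphic chart: on the open set `U` of a
vector space with constant complex structure `J`, a Hermitian metric `g` and a vector field `T`
whose dual form `θ = g(T, ·)` is closed, satisfies `dΩ = θ ∧ Ω` for `Ω = g(J·, ·)`, and has
`(∇θ)^{1,1} = 0`. Here `∇θ` is written with the Christoffel symbols of `g`, see
`flatCovDeriv`. -/
structure IsFlatPluricanonical (J : E →L[ℝ] E) (U : Set E) (g : E → E →L[ℝ] E →L[ℝ] ℝ)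
    (T : E → E) : Prop where
  isOpen : IsOpen U
  contDiffOn_metric : ContDiffOn ℝ ∞ g U
  contDiffOn_field : ContDiffOn ℝ ∞ T U
  sq_eq : ∀ v, J (J v) = -v
  isScalarProduct : ∀ x ∈ U, IsScalarProduct (g x)
  hermitian : ∀ x ∈ U, ∀ u v, g x (J u) (J v) = g x u v
  closed : ∀ x ∈ U, ∀ u v, fderiv ℝ (fun y ↦ g y (T y)) x u v = fderiv ℝ (fun y ↦ g y (T y)) x v u
  lee : ∀ x ∈ U, ∀ X Y Z, fderiv ℝ g x X (J Y) Z + fderiv ℝ g x Y (J Z) X + fderiv ℝ g x Z (J X) Y =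
    g x (T x) X * g x (J Y) Z + g x (T x) Y * g x (J Z) X + g x (T x) Z * g x (J X) Y
  pluricanonical : ∀ x ∈ U, ∀ X Y,
    flatCovDeriv g (fun y ↦ g y (T y)) x (T x) X Y +
      flatCovDeriv g (fun y ↦ g y (T y)) x (T x) (J X) (J Y) = 0

namespace IsFlatPluricanonical

variable {J : E →L[ℝ] E} {U : Set E} {g : E → E →L[ℝ] E →L[ℝ] ℝ} {T : E → E}
  (h : IsFlatPluricanonical J U g T) {x : E} (hx : x ∈ U)
include h

theorem sq_eq_neg_one : J * J = -1 := by
  ext v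
  exact h.sq_eq v

theorem contDiffOn_leeForm : ContDiffOn ℝ ∞ (fun y ↦ g y (T y)) U :=
  h.contDiffOn_metric.clm_apply h.contDiffOn_field

theorem antilinearDeriv_apply_J (x X : E) :
    antilinearDeriv J T x (J X) = -J (antilinearDeriv J T x X) :=
  congr($(antilinearDeriv_mul h.sq_eq_neg_one T x) X)

include hx

theorem differentiableAt_metric : DifferentiableAt ℝ g x :=
  (h.contDiffOn_metric.contDiffAt (h.isOpen.mem_nhds hx)).differentiableAt (by simp)

theorem differentiableAt_field : DifferentiableAt ℝ T x :=
  (h.contDiffOn_field.contDiffAt (h.isOpen.mem_nhds hx)).differentiableAt (by simp)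

theorem fderiv_symm (X Y Z : E) : fderiv ℝ g x X Y Z = fderiv ℝ g x X Z Y := by
  rw [← fderiv_clm_apply_const₂ (h.differentiableAt_metric hx),
    ← fderiv_clm_apply_const₂ (h.differentiableAt_metric hx)]
  refine congr($(Filter.EventuallyEq.fderiv_eq ?_) X)
  filter_upwards [h.isOpen.mem_nhds hx] with y hy using (h.isScalarProduct y hy).symm _ _

theorem fderiv_hermitian (X Y Z : E) : fderiv ℝ g x X (J Y) (J Z) = fderiv ℝ g x X Y Z := by
  rw [← fderiv_clm_apply_const₂ (h.differentiableAt_metric hx),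
    ← fderiv_clm_apply_const₂ (h.differentiableAt_metric hx)]
  refine congr($(Filter.EventuallyEq.fderiv_eq ?_) X)
  filter_upwards [h.isOpen.mem_nhds hx] with y hy using h.hermitian y hy _ _

theorem fderiv_hermitian_right (X Y Z : E) :
    fderiv ℝ g x X Y (J Z) = -fderiv ℝ g x X (J Y) Z := by
  rw [← h.fderiv_hermitian hx X Y, h.sq_eq, map_neg]

theorem hermitian_right (Y Z : E) : g x Y (J Z) = -g x (J Y) Z := by
  rw [← h.hermitian x hx Y, h.sq_eq, map_neg]

theorem fderiv_leeForm (X Y : E) : fderiv ℝ (fun y ↦ g y (T y)) x X Y =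
    fderiv ℝ g x X (T x) Y + g x (fderiv ℝ T x X) Y := by
  rw [((h.differentiableAt_metric hx).hasFDerivAt.clm_apply
    (h.differentiableAt_field hx).hasFDerivAt).fderiv]
  simp [add_comm]

/-- `∇θ` is half of the Lie derivative of `g` along the dual vector field. -/
theorem two_mul_flatCovDeriv (X Y : E) :
    2 * flatCovDeriv g (fun y ↦ g y (T y)) x (T x) X Y =
      fderiv ℝ g x (T x) X Y + g x (fderiv ℝ T x X) Y + g x X (fderiv ℝ T x Y) := by
  have h1 := h.closed x hx X Y
  have h2 := h.fderiv_symm hx X Y (T x)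
  have h3 := h.fderiv_symm hx Y X (T x)
  have h4 := (h.isScalarProduct x hx).symm X (fderiv ℝ T x Y)
  rw [h.fderiv_leeForm hx, h.fderiv_leeForm hx] at h1
  rw [flatCovDeriv, h.fderiv_leeForm hx]
  linarith

theorem flatCovDeriv_symm (X Y : E) : flatCovDeriv g (fun y ↦ g y (T y)) x (T x) X Y =
    flatCovDeriv g (fun y ↦ g y (T y)) x (T x) Y X := by
  have h1 := h.two_mul_flatCovDeriv hx X Y
  have h2 := h.two_mul_flatCovDeriv hx Y X
  have h3 := h.fderiv_symm hx (T x) X Y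
  have h4 := (h.isScalarProduct x hx).symm X (fderiv ℝ T x Y)
  have h5 := (h.isScalarProduct x hx).symm Y (fderiv ℝ T x X)
  linarith

/-- Two expressions for the Lie derivative of `Ω` along `T`: on the left, it is computed from the
Lie derivatives of `g` and `J`, on the right from `dΩ = θ ∧ Ω` by Cartan's formula. -/
theorem lieDeriv_fundamentalForm (X Y : E) :
    2 * flatCovDeriv g (fun y ↦ g y (T y)) x (T x) (J X) Y +
        2 * g x (J (antilinearDeriv J T x X)) Y =
      g x (T x) (T x) * g x (J X) Y + g x (T x) X * g x (T x) (J Y) -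
        g x (T x) Y * g x (T x) (J X) - fderiv ℝ (fun y ↦ g y (T y)) x X (J Y) +
        fderiv ℝ (fun y ↦ g y (T y)) x Y (J X) := by
  have hJS : J (antilinearDeriv J T x X) =
      (1 / 2 : ℝ) • (J (fderiv ℝ T x X) - fderiv ℝ T x (J X)) := by
    have : antilinearDeriv J T x X =
      (1 / 2 : ℝ) • (fderiv ℝ T x X + J (fderiv ℝ T x (J X))) := rfl
    rw [this, map_smul, map_add, h.sq_eq, sub_eq_add_neg]
  have h1 := h.lee x hx (T x) X Y
  have hs := (h.isScalarProduct x hx).symm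
  rw [h.two_mul_flatCovDeriv hx, hJS, h.fderiv_leeForm hx, h.fderiv_leeForm hx]
  simp only [map_smul, map_sub, smul_apply, sub_apply, smul_eq_mul]
  rw [h.hermitian_right hx (fderiv ℝ T x X) Y]
  have e1 := h.fderiv_hermitian_right hx X (T x) Y
  have e2 := h.fderiv_symm hx X (J Y) (T x)
  have e3 := h.fderiv_symm hx X (T x) (J Y)
  have e4 := h.fderiv_hermitian_right hx Y (T x) X
  have e5 := hs (J Y) (T x)
  have e6 := h.hermitian_right hx (T x) X
  have e7 := hs (J X) (fderiv ℝ T x Y)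
  rw [e5] at h1
  have e8 : g x (J (T x)) X = -g x (T x) (J X) := by linarith
  rw [e8] at h1
  linarith

/-- The Lie derivative of `Ω` along `T` vanishes. -/
theorem flatCovDeriv_J_add (X Y : E) :
    flatCovDeriv g (fun y ↦ g y (T y)) x (T x) (J X) Y + g x (J (antilinearDeriv J T x X)) Y = 0 := by
  -- the left-hand side is `J`-anti-invariant, the right-hand side of `lieDeriv_fundamentalForm`
  -- is `J`-invariant
  have h1 := h.lieDeriv_fundamentalForm hx X Y
  have h2 := h.lieDeriv_fundamentalForm hx (J X) (J Y)
  have h3 := h.pluricanonical x hx (J X) Y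
  rw [h.antilinearDeriv_apply_J x, map_neg J, map_neg (g x), neg_apply, h.hermitian x hx,
    h.hermitian_right hx] at h2
  have c1 := h.closed x hx (J X) Y
  have c2 := h.closed x hx (J Y) X
  simp only [h.sq_eq, map_neg, neg_apply] at h2 h3
  linarith

/-- `∇θ` is given by the antilinear part of the derivative of the dual vector field. -/
theorem flatCovDeriv_eq (X Y : E) : flatCovDeriv g (fun y ↦ g y (T y)) x (T x) X Y =
    g x (antilinearDeriv J T x X) Y := by
  have h1 := h.flatCovDeriv_J_add hx X (J Y)
  have h2 := h.pluricanonical x hx X Y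
  rw [h.hermitian x hx] at h1
  linarith

theorem antilinearDeriv_symm (X Y : E) :
    g x (antilinearDeriv J T x X) Y = g x X (antilinearDeriv J T x Y) := by
  rw [← h.flatCovDeriv_eq hx, h.flatCovDeriv_symm hx, h.flatCovDeriv_eq hx,
    (h.isScalarProduct x hx).symm]

/-- The formula `d(Jθ) = |θ|² Ω + θ ∧ Jθ`, where `Jθ = θ ∘ J`. -/
theorem extDeriv_J_leeForm (X Y : E) :
    fderiv ℝ (fun y ↦ g y (T y)) x X (J Y) - fderiv ℝ (fun y ↦ g y (T y)) x Y (J X) =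
      g x (T x) (T x) * g x (J X) Y + g x (T x) X * g x (T x) (J Y) -
        g x (T x) Y * g x (T x) (J X) := by
  have h1 := h.lieDeriv_fundamentalForm hx X Y
  have h2 := h.flatCovDeriv_J_add hx X Y
  linarith

set_option synthInstance.maxHeartbeats 200000 in
/-- The derivative of `extDeriv_J_leeForm` in the direction `Z`. -/
theorem fderiv_extDeriv_J_leeForm (X Y Z : E) :
    fderiv ℝ (fderiv ℝ (fun y ↦ g y (T y))) x Z X (J Y) -
        fderiv ℝ (fderiv ℝ (fun y ↦ g y (T y))) x Z Y (J X) =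
      fderiv ℝ (fun y ↦ g y (T y) (T y)) x Z * g x (J X) Y +
        g x (T x) (T x) * fderiv ℝ g x Z (J X) Y +
        fderiv ℝ (fun y ↦ g y (T y)) x Z X * g x (T x) (J Y) +
        g x (T x) X * fderiv ℝ (fun y ↦ g y (T y)) x Z (J Y) -
        fderiv ℝ (fun y ↦ g y (T y)) x Z Y * g x (T x) (J X) -
        g x (T x) Y * fderiv ℝ (fun y ↦ g y (T y)) x Z (J X) := by
  set θ := fun y ↦ g y (T y) with hθ
  have hθx := h.contDiffOn_leeForm.contDiffAt (h.isOpen.mem_nhds hx)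
  have d1 : HasFDerivAt θ (fderiv ℝ θ x) x := (hθx.differentiableAt (by simp)).hasFDerivAt
  have d2 : HasFDerivAt (fderiv ℝ θ) (fderiv ℝ (fderiv ℝ θ) x) x :=
    hasFDerivAt_fderiv hθx
  have dT := (h.differentiableAt_field hx).hasFDerivAt
  have dq : HasFDerivAt (fun y ↦ θ y (T y)) (fderiv ℝ (fun y ↦ θ y (T y)) x) x :=
    (d1.clm_apply dT).differentiableAt.hasFDerivAt
  have dg := (h.differentiableAt_metric hx).hasFDerivAt
  have cst : ∀ v : E, HasFDerivAt (fun _ : E ↦ v) (0 : E →L[ℝ] E) x := fun v ↦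
    hasFDerivAt_const v x
  have ap : ∀ v, HasFDerivAt (fun y ↦ θ y v) ((fderiv ℝ θ x).flip v) x := fun v ↦ by
    simpa using d1.clm_apply (cst v)
  have ap2 : ∀ v w, HasFDerivAt (fun y ↦ fderiv ℝ θ y v w)
      (((fderiv ℝ (fderiv ℝ θ) x).flip v).flip w) x := fun v w ↦ by
    simpa using (d2.clm_apply (cst v)).clm_apply (cst w)
  have apg : ∀ v w, HasFDerivAt (fun y ↦ g y v w) (((fderiv ℝ g x).flip v).flip w) x :=
    fun v w ↦ by simpa using (dg.clm_apply (cst v)).clm_apply (cst w)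
  have hL := (ap2 X (J Y)).sub (ap2 Y (J X))
  have hR := ((dq.mul (apg (J X) Y)).add ((ap X).mul (ap (J Y)))).sub ((ap Y).mul (ap (J X)))
  have heq := Filter.EventuallyEq.fderiv_eq (𝕜 := ℝ) (Filter.eventuallyEq_of_mem
    (h.isOpen.mem_nhds hx) fun y hy ↦ h.extDeriv_J_leeForm hy X Y)
  have h1 := congr($(hL.fderiv.symm.trans (heq.trans hR.fderiv)) Z)
  simp only [sub_apply, add_apply, smul_apply, ContinuousLinearMap.flip_apply, smul_eq_mul] at h1
  rw [h1]
  simp only [hθ]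
  ring

theorem fderiv_sq_norm (X : E) : fderiv ℝ (fun y ↦ g y (T y) (T y)) x X =
    2 * g x (antilinearDeriv J T x X) (T x) := by
  have d1 : DifferentiableAt ℝ (fun y ↦ g y (T y)) x :=
    (h.differentiableAt_metric hx).clm_apply (h.differentiableAt_field hx)
  rw [← h.flatCovDeriv_eq hx, flatCovDeriv,
    (d1.hasFDerivAt.clm_apply (h.differentiableAt_field hx).hasFDerivAt).fderiv]
  simp only [add_apply, ContinuousLinearMap.comp_apply, ContinuousLinearMap.flip_apply]
  rw [h.fderiv_leeForm hx, (h.isScalarProduct x hx).symm (T x)]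
  ring

/-- The norm of the Lee form is locally constant: the exterior derivative of
`d(Jθ) = |θ|² Ω + θ ∧ Jθ` reduces to `d|θ|² ∧ Ω = 0`. -/
theorem fderiv_sq_norm_eq_zero [FiniteDimensional ℝ E] (hdim : 2 < Module.finrank ℝ E) (X : E) :
    fderiv ℝ (fun y ↦ g y (T y) (T y)) x X = 0 := by
  refine (h.isScalarProduct x hx).eq_zero_of_wedge h.sq_eq (h.hermitian x hx) hdim
    (fun X Y Z ↦ ?_) X
  have hθx := h.contDiffOn_leeForm.contDiffAt (h.isOpen.mem_nhds hx)
  have s := fun u v ↦ congr($(fderiv_fderiv_comm hθx u v))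
  have d1 := h.fderiv_extDeriv_J_leeForm hx X Y Z
  have d2 := h.fderiv_extDeriv_J_leeForm hx Y Z X
  have d3 := h.fderiv_extDeriv_J_leeForm hx Z X Y
  rw [s Z X, s Z Y] at d1
  rw [s X Y] at d2
  have l1 := h.lee x hx X Y Z
  have e1 := h.extDeriv_J_leeForm hx X Y
  have e2 := h.extDeriv_J_leeForm hx Y Z
  have e3 := h.extDeriv_J_leeForm hx Z X
  have c1 := h.closed x hx Z X
  have c2 := h.closed x hx Z Y
  have c3 := h.closed x hx X Y
  rw [c1, c2] at d1
  rw [c3] at d2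
  linear_combination -d1 - d2 - d3 - g x (T x) (T x) * l1 + g x (T x) Z * e1 + g x (T x) X * e2 +
    g x (T x) Y * e3

/-- As `|θ|²` is constant, `∇T` annihilates `T`. -/
theorem antilinearDeriv_self [FiniteDimensional ℝ E] (hdim : 2 < Module.finrank ℝ E) :
    antilinearDeriv J T x (T x) = 0 := by
  refine (h.isScalarProduct x hx).ext fun w ↦ ?_
  have h1 := h.fderiv_sq_norm hx w
  rw [h.fderiv_sq_norm_eq_zero hx hdim] at h1
  rw [h.antilinearDeriv_symm hx, (h.isScalarProduct x hx).symm, map_zero, zero_apply]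
  linarith

/-- The Lie derivative of `S = ∇T` along `T` is self-adjoint: since the Lie derivative of `g` along
`T` is `2 g(S·, ·)`, that of the symmetric form `g(S·, ·)` is `2 g(S²·, ·)` plus the form of the Lie
derivative of `S`. -/
theorem lieDeriv_antilinearDeriv_symm (X Y : E) {C : E →L[ℝ] E}
    (hC : C = fderiv ℝ (antilinearDeriv J T) x (T x) + antilinearDeriv J T x * fderiv ℝ T x -
      fderiv ℝ T x * antilinearDeriv J T x) :
    g x (C X) Y = g x X (C Y) := by
  have hS : HasFDerivAt (antilinearDeriv J T) (fderiv ℝ (antilinearDeriv J T) x) x :=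
    (((contDiffOn_antilinearDeriv h.isOpen h.contDiffOn_field).contDiffAt
      (h.isOpen.mem_nhds hx)).differentiableAt (by simp)).hasFDerivAt
  have dg := (h.differentiableAt_metric hx).hasFDerivAt
  have cst : ∀ v : E, HasFDerivAt (fun _ : E ↦ v) (0 : E →L[ℝ] E) x := fun v ↦
    hasFDerivAt_const v x
  have hL := (dg.clm_apply (hS.clm_apply (cst X))).clm_apply (cst Y)
  have hR := (dg.clm_apply (cst X)).clm_apply (hS.clm_apply (cst Y))
  have heq := Filter.EventuallyEq.fderiv_eq (𝕜 := ℝ) (Filter.eventuallyEq_of_mem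
    (h.isOpen.mem_nhds hx) fun y hy ↦ h.antilinearDeriv_symm hy X Y)
  have h1 := congr($(hL.fderiv.symm.trans (heq.trans hR.fderiv)) (T x))
  simp only [add_apply, ContinuousLinearMap.comp_apply, ContinuousLinearMap.flip_apply, zero_apply,
    map_zero, zero_add] at h1
  have e1 := h.two_mul_flatCovDeriv hx (antilinearDeriv J T x X) Y
  have e2 := h.two_mul_flatCovDeriv hx X (antilinearDeriv J T x Y)
  rw [h.flatCovDeriv_eq hx] at e1 e2
  have s1 := h.antilinearDeriv_symm hx (antilinearDeriv J T x X) Y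
  have s2 := h.antilinearDeriv_symm hx X (antilinearDeriv J T x Y)
  have s3 := h.antilinearDeriv_symm hx X (fderiv ℝ T x Y)
  have s4 := h.antilinearDeriv_symm hx (fderiv ℝ T x X) Y
  simp only [hC, add_apply, sub_apply, map_add, map_sub, mul_clm_apply]
  linarith

/-- The maximum principle: `∇θ` vanishes where its norm has a local maximum. -/
theorem antilinearDeriv_eq_zero [FiniteDimensional ℝ E] (hdim : 2 < Module.finrank ℝ E)
    (hmax : IsLocalMax (fun y ↦ traceCLM E (antilinearDeriv J T y * antilinearDeriv J T y)) x) :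
    antilinearDeriv J T x = 0 := by
  have hSm := contDiffOn_antilinearDeriv (J := J) h.isOpen h.contDiffOn_field
  have hu : ContDiffAt ℝ 2 (fun y ↦ traceCLM E (antilinearDeriv J T y * antilinearDeriv J T y)) x :=
    (((traceCLM E).contDiff.comp_contDiffOn (hSm.clm_comp hSm)).contDiffAt
      (h.isOpen.mem_nhds hx)).of_le
      (WithTop.coe_le_coe.2 (le_top (a := (2 : ℕ∞))))
  have h1 := fderiv_fderiv_nonpos_of_isLocalMax hu hmax (T x)
  have h2 := fderiv_fderiv_nonpos_of_isLocalMax hu hmax (J (T x))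
  have h3 := laplacian_trace_sq h.isOpen h.sq_eq_neg_one h.contDiffOn_field
    (fun y hy ↦ h.antilinearDeriv_self hy hdim) hx rfl rfl
  have hg := h.isScalarProduct x hx
  have h4 := (hg.trace_sq fun u v ↦ h.lieDeriv_antilinearDeriv_symm hx u v rfl).1
  have hs := h.antilinearDeriv_symm hx
  have h5 := hg.trace_sq (A := antilinearDeriv J T x * antilinearDeriv J T x) fun u v ↦ by
    rw [mul_clm_apply, mul_clm_apply, hs, hs]
  have h6 := h5.2 (le_antisymm (by linarith) h5.1)
  exact (hg.trace_sq hs).2 (by rw [h6, map_zero])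

end IsFlatPluricanonical

end FlatPluricanonical

/-! ### Vector fields, metrics and connections in a chart -/

section Chart

variable {E : Type*} [NormedAddCommGroup E] [NormedSpace ℝ E]
  {M : Type*} [TopologicalSpace M] [ChartedSpace E M]

/-- The constant vector field with value `v` on a vector space. -/
def constField (v : E) : Π z : E, TangentSpace 𝓘(ℝ, E) z := fun _ ↦ v

/-- The coordinate vector field with constant value `v` in the chart at `p`. -/
noncomputable def coordField (p : M) (v : E) : Π y : M, TangentSpace 𝓘(ℝ, E) y :=
  mpullback 𝓘(ℝ, E) 𝓘(ℝ, E) (extChartAt 𝓘(ℝ, E) p) (constField v)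

/-- The tangent map at `y` of the chart at `p`. -/
noncomputable def chartDeriv (p y : M) : TangentSpace 𝓘(ℝ, E) y →L[ℝ] E :=
  mfderiv 𝓘(ℝ, E) 𝓘(ℝ, E) (extChartAt 𝓘(ℝ, E) p) y

/-- The tangent map of the inverse of the chart at `p`, sending `v` to the value at `y` of
`coordField p v`. -/
noncomputable def coordMap (p y : M) : E →L[ℝ] TangentSpace 𝓘(ℝ, E) y :=
  (chartDeriv p y).inverse

theorem coordField_apply (p y : M) (v : E) : coordField p v y = coordMap p y v := rfl

variable [IsManifold 𝓘(ℝ, E) ∞ M]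

theorem isInvertible_chartDeriv {p y : M} (hy : y ∈ (chartAt E p).source) :
    (chartDeriv (E := E) p y).IsInvertible :=
  isInvertible_mfderiv_extChartAt (I := 𝓘(ℝ, E)) (by simpa using hy)

theorem chartDeriv_coordMap {p y : M} (hy : y ∈ (chartAt E p).source) (v : E) :
    chartDeriv p y (coordMap p y v) = v := by
  obtain ⟨e, he⟩ := isInvertible_chartDeriv (E := E) hy
  rw [coordMap, ← he, ContinuousLinearMap.inverse_equiv]
  exact e.apply_symm_apply v

theorem coordMap_chartDeriv {p y : M} (hy : y ∈ (chartAt E p).source)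
    (v : TangentSpace 𝓘(ℝ, E) y) : coordMap p y (chartDeriv p y v) = v := by
  obtain ⟨e, he⟩ := isInvertible_chartDeriv (E := E) hy
  rw [coordMap, ← he, ContinuousLinearMap.inverse_equiv]
  exact e.symm_apply_apply v

theorem contMDiffAt_constField (v z : E) :
    ContMDiffAt 𝓘(ℝ, E) 𝓘(ℝ, E).tangent ∞
      (fun y ↦ (⟨y, constField v y⟩ : TangentBundle 𝓘(ℝ, E) E)) z := by
  rw [contMDiffAt_vectorSpace_iff_contDiffAt]
  exact contDiffAt_const

theorem contMDiffAt_coordField [CompleteSpace E] {p y : M} (hy : y ∈ (chartAt E p).source)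
    (v : E) : ContMDiffAt 𝓘(ℝ, E) 𝓘(ℝ, E).tangent ∞
      (fun y ↦ (⟨y, coordField p v y⟩ : TangentBundle 𝓘(ℝ, E) M)) y :=
  ContMDiffAt.mpullback_vectorField_preimage (n := ∞) (contMDiffAt_constField v _)
    (contMDiffAt_extChartAt' hy) (isInvertible_chartDeriv (E := E) hy) (by simp)

theorem mdifferentiableAt_coordField [CompleteSpace E] {p y : M}
    (hy : y ∈ (chartAt E p).source) (v : E) : DiffFieldAt 𝓘(ℝ, E) (coordField p v) y :=
  (contMDiffAt_coordField hy v).mdifferentiableAt (by simp)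

theorem mlieBracket_constField (v w z : E) :
    mlieBracket 𝓘(ℝ, E) (constField v) (constField w) z = 0 := by
  rw [← mlieBracketWithin_univ, mlieBracketWithin_eq_lieBracketWithin]
  change fderivWithin ℝ (fun _ : E ↦ w) Set.univ z v - fderivWithin ℝ (fun _ : E ↦ v) Set.univ z w = 0
  simp

theorem mlieBracket_coordField [CompleteSpace E] {p y : M} (hy : y ∈ (chartAt E p).source)
    (v w : E) : mlieBracket 𝓘(ℝ, E) (coordField p v) (coordField p w) y = 0 := by
  have h2 : IsManifold 𝓘(ℝ, E) (minSmoothness ℝ 2) M := by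
    rw [minSmoothness_of_isRCLikeNormedField]; infer_instance
  have h3 : IsManifold 𝓘(ℝ, E) (minSmoothness ℝ 3) M := by
    rw [minSmoothness_of_isRCLikeNormedField]; infer_instance
  have h := mpullback_mlieBracket (n := ∞)
    ((contMDiffAt_constField v (extChartAt 𝓘(ℝ, E) p y)).mdifferentiableAt (by simp))
    ((contMDiffAt_constField w (extChartAt 𝓘(ℝ, E) p y)).mdifferentiableAt (by simp))
    (contMDiffAt_extChartAt' (I := 𝓘(ℝ, E)) (n := ∞) hy)
    (by simpa using WithTop.coe_le_coe.2 (le_top (a := (2 : ℕ∞))))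
  rw [coordField, coordField, ← h, mpullback_apply, mlieBracket_constField, map_zero]

theorem mvfderiv_coordMap {F : Type*} [NormedAddCommGroup F] [NormedSpace ℝ F] {f : M → F}
    {fc : E → F} {p y : M} (hy : y ∈ (chartAt E p).source)
    (hf : DifferentiableAt ℝ fc (chartAt E p y)) (h : f =ᶠ[nhds y] fc ∘ chartAt E p) (v : E) :
    mvfderiv 𝓘(ℝ, E) f y (coordMap p y v) = fderiv ℝ fc (chartAt E p y) v := by
  have h1 : mfderiv 𝓘(ℝ, E) 𝓘(ℝ, F) f y =
      mfderiv 𝓘(ℝ, E) 𝓘(ℝ, F) (fc ∘ extChartAt 𝓘(ℝ, E) p) y := Filter.EventuallyEq.mfderiv_eq h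
  have h2 := mfderiv_comp_apply y (g := fc) (f := extChartAt 𝓘(ℝ, E) p)
    (I := 𝓘(ℝ, E)) (I' := 𝓘(ℝ, E)) (I'' := 𝓘(ℝ, F)) hf.mdifferentiableAt
    ((contMDiffAt_extChartAt' (n := ∞) hy).mdifferentiableAt (by simp)) (coordMap p y v)
  change mfderiv 𝓘(ℝ, E) 𝓘(ℝ, F) f y (coordMap p y v) = _
  rw [h1]
  refine h2.trans ?_
  change mfderiv 𝓘(ℝ, E) 𝓘(ℝ, F) fc (chartAt E p y) (chartDeriv (E := E) p y (coordMap p y v)) = _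
  rw [chartDeriv_coordMap hy, mfderiv_eq_fderiv]
  rfl

/-- The field of bilinear forms `g` read in the chart at `p`. It has a meaning only on the target of
the chart. -/
noncomputable def chartMetric
    (g : Π y : M, TangentSpace 𝓘(ℝ, E) y →L[ℝ] TangentSpace 𝓘(ℝ, E) y →L[ℝ] ℝ) (p : M) (z : E) :
    E →L[ℝ] E →L[ℝ] ℝ :=
  ContinuousLinearMap.precomp ℝ (coordMap p ((chartAt E p).symm z)) ∘L
    g ((chartAt E p).symm z) ∘L coordMap p ((chartAt E p).symm z)

omit [IsManifold 𝓘(ℝ, E) ∞ M] in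
theorem chartMetric_apply
    (g : Π y : M, TangentSpace 𝓘(ℝ, E) y →L[ℝ] TangentSpace 𝓘(ℝ, E) y →L[ℝ] ℝ) {p y : M}
    (hy : y ∈ (chartAt E p).source) (v w : E) :
    chartMetric g p (chartAt E p y) v w = g y (coordMap p y v) (coordMap p y w) := by
  have := (chartAt E p).left_inv hy
  simp [chartMetric]
  rw [this]

section Metric

variable [FiniteDimensional ℝ E]
  (g : ContMDiffRiemannianMetric 𝓘(ℝ, E) ∞ E (TangentSpace 𝓘(ℝ, E) : M → Type _))

theorem contDiffOn_chartMetric (p : M) :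
    ContDiffOn ℝ ∞ (chartMetric g.inner p) (chartAt E p).target := by
  refine contDiffOn_clm_apply.2 fun v ↦ contDiffOn_clm_apply.2 fun w ↦ ?_
  have h1 : ContMDiffOn 𝓘(ℝ, E) 𝓘(ℝ) ∞
      (fun y ↦ g.inner y (coordField p v y) (coordField p w y)) (chartAt E p).source := by
    intro y hy
    have : ContMDiffAt 𝓘(ℝ, E) (𝓘(ℝ, E).prod 𝓘(ℝ)) ∞
        (fun m ↦ TotalSpace.mk' ℝ (E := Bundle.Trivial M ℝ) m
          (g.inner m (coordField p v m) (coordField p w m))) y := by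
      apply ContMDiffAt.clm_bundle_apply₂ (F₁ := E) (F₂ := E)
      · exact g.contMDiff.contMDiffAt
      · exact contMDiffAt_coordField hy v
      · exact contMDiffAt_coordField hy w
    simp only [contMDiffAt_totalSpace] at this
    exact this.2.contMDiffWithinAt
  have h2 := h1.comp (contMDiffOn_chart_symm (x := p)) (fun z hz ↦ (chartAt E p).map_target hz)
  exact contMDiffOn_iff_contDiffOn.1 h2

theorem mvfderiv_inner_coordField {p y : M} (hy : y ∈ (chartAt E p).source) (a b c : E) :
    mvfderiv 𝓘(ℝ, E) (fun y ↦ g.inner y (coordField p b y) (coordField p c y)) y (coordMap p y a) =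
      fderiv ℝ (chartMetric g.inner p) (chartAt E p y) a b c := by
  have hd : DifferentiableAt ℝ (chartMetric g.inner p) (chartAt E p y) :=
    ((contDiffOn_chartMetric g p).contDiffAt ((chartAt E p).open_target.mem_nhds
      ((chartAt E p).map_source hy))).differentiableAt (by simp)
  rw [← fderiv_clm_apply_const₂ hd]
  refine mvfderiv_coordMap hy ((hd.clm_apply (differentiableAt_const b)).clm_apply
    (differentiableAt_const c)) ?_ a
  filter_upwards [(chartAt E p).open_source.mem_nhds hy] with x hx
  exact (chartMetric_apply g.inner hx b c).symm

omit [FiniteDimensional ℝ E] in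
/-- The Koszul formula. -/
theorem IsLeviCivita.koszul_eq {cov : CovariantDerivative 𝓘(ℝ, E) E (TangentSpace 𝓘(ℝ, E) : M → Type _)}
    (h : IsLeviCivita g cov) {x : M} {X Y Z : Π y : M, TangentSpace 𝓘(ℝ, E) y}
    (hX : MDiffAt (T% X) x) (hY : MDiffAt (T% Y) x) (hZ : MDiffAt (T% Z) x) :
    2 * g.inner x (cov Y x (X x)) (Z x) = koszul g X Y Z x := by
  simp only [koszul, ← h.torsion_free x _ _ hX hY, ← h.torsion_free x _ _ hX hZ,
    ← h.torsion_free x _ _ hY hZ, h.metric x _ _ _ hX hY, h.metric x _ _ _ hX hZ,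
    h.metric x _ _ _ hY hZ]
  simp only [map_sub, sub_apply]
  rw [g.symm x (Y x) (cov Z x (X x)), g.symm x (X x) (cov Z x (Y x)),
    g.symm x (X x) (cov Y x (Z x))]
  ring

/-- The Christoffel symbols of the Levi-Civita connection. -/
theorem two_mul_inner_leviCivita_coordField {p y : M} (hy : y ∈ (chartAt E p).source) (a b c : E) :
    2 * g.inner y (leviCivita g (coordField p b) y (coordMap p y a)) (coordMap p y c) =
      fderiv ℝ (chartMetric g.inner p) (chartAt E p y) a b c +
        fderiv ℝ (chartMetric g.inner p) (chartAt E p y) b a c -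
        fderiv ℝ (chartMetric g.inner p) (chartAt E p y) c a b := by
  have h := (isLeviCivita_leviCivita g).koszul_eq g (mdifferentiableAt_coordField hy a)
    (mdifferentiableAt_coordField hy b) (mdifferentiableAt_coordField hy c)
  rw [koszul] at h
  simp only [mlieBracket_coordField hy, map_zero, zero_apply] at h
  simp only [← mvfderiv_inner_coordField g hy]
  simp only [coordField_apply] at h ⊢
  linarith

theorem exists_dual (x : M) (α : TangentSpace 𝓘(ℝ, E) x →L[ℝ] ℝ) :
    ∃ t : TangentSpace 𝓘(ℝ, E) x, ∀ v, g.inner x t v = α v := by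
  have hb : IsScalarProduct (E := E) (g.inner x) := ⟨g.symm x, g.pos x⟩
  obtain ⟨e, he⟩ := hb.isInvertible
  refine ⟨e.symm α, fun v ↦ ?_⟩
  exact (congr($he (e.symm α) v)).symm.trans congr($(e.apply_symm_apply α) v)

/-- The vector field dual to the `1`-form `θ`, so that `θ = g(T, ·)`. -/
noncomputable def dualField (θ : Π x : M, TangentSpace 𝓘(ℝ, E) x →L[ℝ] ℝ) (x : M) :
    TangentSpace 𝓘(ℝ, E) x :=
  (exists_dual g x (θ x)).choose

theorem inner_dualField (θ : Π x : M, TangentSpace 𝓘(ℝ, E) x →L[ℝ] ℝ) (x : M)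
    (v : TangentSpace 𝓘(ℝ, E) x) : g.inner x (dualField g θ x) v = θ x v :=
  (exists_dual g x (θ x)).choose_spec v

/-- `∇θ` is dual to `∇T`, where `T` is the vector field dual to `θ`. -/
theorem covDerivOneForm_eq_inner {θ : Π x : M, TangentSpace 𝓘(ℝ, E) x →L[ℝ] ℝ} {x : M}
    (hT : DiffFieldAt 𝓘(ℝ, E) (dualField g θ) x) {Y : Π x : M, TangentSpace 𝓘(ℝ, E) x}
    (hY : DiffFieldAt 𝓘(ℝ, E) Y x) (v : TangentSpace 𝓘(ℝ, E) x) :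
    covDerivOneForm (leviCivita g) θ Y x v =
      g.inner x (leviCivita g (dualField g θ) x v) (Y x) := by
  have h := (isLeviCivita_leviCivita g).metric x _ _ v hT hY
  simp only [inner_dualField] at h
  rw [covDerivOneForm, h, add_sub_cancel_right]

end Metric

/-! ### Exact forms in a chart -/

section Exact

variable [FiniteDimensional ℝ E]
  {g : ContMDiffRiemannianMetric 𝓘(ℝ, E) ∞ E (TangentSpace 𝓘(ℝ, E) : M → Type _)}
  {θ : Π x : M, TangentSpace 𝓘(ℝ, E) x →L[ℝ] ℝ} {f : M → ℝ} {U : Set M}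

/-- The image of `U` in the chart at `p`. -/
def chartImage (p : M) (U : Set M) : Set E := (chartAt E p).target ∩ (chartAt E p).symm ⁻¹' U

omit [FiniteDimensional ℝ E] [NormedSpace ℝ E] [IsManifold 𝓘(ℝ, E) ∞ M] in
theorem isOpen_chartImage (p : M) (hU : IsOpen U) : IsOpen (chartImage (E := E) p U) :=
  (chartAt E p).isOpen_inter_preimage_symm hU

omit [FiniteDimensional ℝ E] in
theorem contDiffOn_chartImage (p : M) (hf : ContMDiffOn 𝓘(ℝ, E) 𝓘(ℝ) ∞ f U) :
    ContDiffOn ℝ ∞ (f ∘ (chartAt E p).symm) (chartImage p U) :=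
  contMDiffOn_iff_contDiffOn.1 (hf.comp ((contMDiffOn_chart_symm (x := p)).mono
    Set.inter_subset_left) fun _ hz ↦ hz.2)

omit [NormedSpace ℝ E] [IsManifold 𝓘(ℝ, E) ∞ M] [FiniteDimensional ℝ E] in
theorem mem_chartImage {p y : M} (hy : y ∈ (chartAt E p).source) (hyU : y ∈ U) :
    chartAt E p y ∈ chartImage p U :=
  ⟨(chartAt E p).map_source hy, by simpa [(chartAt E p).left_inv hy] using hyU⟩

omit [FiniteDimensional ℝ E] in
theorem mvfderiv_eq_chart (hU : IsOpen U) (hf : ContMDiffOn 𝓘(ℝ, E) 𝓘(ℝ) ∞ f U) {p y : M}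
    (hy : y ∈ (chartAt E p).source) (hyU : y ∈ U) (v : E) :
    mvfderiv 𝓘(ℝ, E) f y (coordMap p y v) =
      fderiv ℝ (f ∘ (chartAt E p).symm) (chartAt E p y) v := by
  refine mvfderiv_coordMap hy (((contDiffOn_chartImage p hf).contDiffAt
    ((isOpen_chartImage p hU).mem_nhds (mem_chartImage hy hyU))).differentiableAt (by simp)) ?_ v
  filter_upwards [(chartAt E p).open_source.mem_nhds hy] with x hx
  simp [(chartAt E p).left_inv hx]

variable (g f) in
/-- The gradient of `f` with respect to `g`, read in the chart at `p`. -/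
noncomputable def chartGrad (p : M) (z : E) : E :=
  (chartMetric g.inner p z).inverse (fderiv ℝ (f ∘ (chartAt E p).symm) z)

omit [FiniteDimensional ℝ E] in
theorem isScalarProduct_chartMetric {p : M} {z : E} (hz : z ∈ (chartAt E p).target) :
    IsScalarProduct (chartMetric g.inner p z) := by
  have hy := (chartAt E p).map_target hz
  have h := chartMetric_apply (E := E) g.inner hy
  rw [(chartAt E p).right_inv hz] at h
  refine ⟨fun u v ↦ ?_, fun u hu ↦ ?_⟩
  · rw [h, h, g.symm]
  · rw [h]
    refine g.pos _ _ fun h0 ↦ hu ?_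
    rw [← chartDeriv_coordMap hy u, h0, map_zero]

theorem chartMetric_chartGrad {p : M} {z : E} (hz : z ∈ (chartAt E p).target) :
    chartMetric g.inner p z (chartGrad g f p z) = fderiv ℝ (f ∘ (chartAt E p).symm) z := by
  obtain ⟨e, he⟩ := (isScalarProduct_chartMetric (g := g) hz).isInvertible
  rw [chartGrad, ← he, ContinuousLinearMap.inverse_equiv]
  exact e.apply_symm_apply _

theorem contDiffOn_chartGrad (p : M) (hU : IsOpen U) (hf : ContMDiffOn 𝓘(ℝ, E) 𝓘(ℝ) ∞ f U) :
    ContDiffOn ℝ ∞ (chartGrad g f p) (chartImage p U) := by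
  have h1 := (contDiffOn_chartImage p hf).fderiv_of_isOpen (isOpen_chartImage p hU) (m := ∞)
    (by simp)
  refine ContDiffOn.clm_apply (fun z hz ↦ ?_) h1
  obtain ⟨e, he⟩ := (isScalarProduct_chartMetric (g := g) hz.1).isInvertible
  have h2 : ContDiffAt ℝ ∞ ContinuousLinearMap.inverse (chartMetric g.inner p z) :=
    he ▸ contDiffAt_map_inverse e
  exact h2.comp_contDiffWithinAt z (((contDiffOn_chartMetric g p).mono Set.inter_subset_left) z hz)

theorem coordMap_chartGrad (hU : IsOpen U) (hf : ContMDiffOn 𝓘(ℝ, E) 𝓘(ℝ) ∞ f U)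
    (hθ : ∀ y ∈ U, θ y = mvfderiv 𝓘(ℝ, E) f y) {p y : M} (hy : y ∈ (chartAt E p).source)
    (hyU : y ∈ U) : coordMap p y (chartGrad g f p (chartAt E p y)) = dualField g θ y := by
  refine inner_ext g fun Z _ ↦ ?_
  rw [inner_dualField, hθ y hyU, ← coordMap_chartDeriv hy (Z y), mvfderiv_eq_chart hU hf hy hyU,
    ← chartMetric_apply g.inner hy, chartMetric_chartGrad ((chartAt E p).map_source hy)]

theorem diffFieldAt_dualField (hU : IsOpen U) (hf : ContMDiffOn 𝓘(ℝ, E) 𝓘(ℝ) ∞ f U)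
    (hθ : ∀ y ∈ U, θ y = mvfderiv 𝓘(ℝ, E) f y) {y : M} (hyU : y ∈ U) :
    DiffFieldAt 𝓘(ℝ, E) (dualField g θ) y := by
  have hy := mem_chart_source E y
  let V : Π z : E, TangentSpace 𝓘(ℝ, E) z := chartGrad g f y
  have hV : ContMDiffAt 𝓘(ℝ, E) 𝓘(ℝ, E).tangent ∞ (fun z ↦ (⟨z, V z⟩ : TangentBundle 𝓘(ℝ, E) E))
      (extChartAt 𝓘(ℝ, E) y y) := by
    rw [contMDiffAt_vectorSpace_iff_contDiffAt]
    exact (contDiffOn_chartGrad y hU hf).contDiffAt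
      ((isOpen_chartImage y hU).mem_nhds (mem_chartImage hy hyU))
  have h1 := (ContMDiffAt.mpullback_vectorField_preimage (n := ∞) hV
    (contMDiffAt_extChartAt' hy) (isInvertible_chartDeriv (E := E) hy)
    (by simp)).mdifferentiableAt (by simp)
  refine h1.congr_of_eventuallyEq ?_
  filter_upwards [(chartAt E y).open_source.mem_nhds hy, hU.mem_nhds hyU] with x hx hxU
  rw [← coordMap_chartGrad hU hf hθ hx hxU]
  rfl

/-- `∇θ` on coordinate vector fields. -/
theorem covDerivOneForm_coordField (hU : IsOpen U) (hf : ContMDiffOn 𝓘(ℝ, E) 𝓘(ℝ) ∞ f U)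
    (hθ : ∀ y ∈ U, θ y = mvfderiv 𝓘(ℝ, E) f y) {p y : M} (hy : y ∈ (chartAt E p).source)
    (hyU : y ∈ U) (a b : E) :
    covDerivOneForm (leviCivita g) θ (coordField p b) y (coordMap p y a) =
      flatCovDeriv (chartMetric g.inner p) (fun z ↦ chartMetric g.inner p z (chartGrad g f p z))
        (chartAt E p y) (chartGrad g f p (chartAt E p y)) a b := by
  have hz := mem_chartImage (E := E) hy hyU
  have hV := (isOpen_chartImage (E := E) p hU).mem_nhds hz
  have hd : DifferentiableAt ℝ (fun z ↦ chartMetric g.inner p z (chartGrad g f p z))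
      (chartAt E p y) :=
    ((((contDiffOn_chartMetric g p).mono Set.inter_subset_left).clm_apply
      (contDiffOn_chartGrad p hU hf)).contDiffAt hV).differentiableAt (by simp)
  have h1 : mvfderiv 𝓘(ℝ, E) (fun y ↦ θ y (coordField p b y)) y (coordMap p y a) =
      fderiv ℝ (fun z ↦ chartMetric g.inner p z (chartGrad g f p z) b) (chartAt E p y) a := by
    refine mvfderiv_coordMap hy (hd.clm_apply (differentiableAt_const b)) ?_ a
    filter_upwards [(chartAt E p).open_source.mem_nhds hy, hU.mem_nhds hyU] with x hx hxU
    rw [Function.comp_apply, chartMetric_apply g.inner hx, coordMap_chartGrad hU hf hθ hx hxU,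
      inner_dualField]
    rfl
  have h2 := two_mul_inner_leviCivita_coordField g hy a b (chartGrad g f p (chartAt E p y))
  rw [coordMap_chartGrad hU hf hθ hy hyU, g.symm, inner_dualField] at h2
  rw [covDerivOneForm, h1, (hd.hasFDerivAt.clm_apply (hasFDerivAt_const b _)).fderiv, flatCovDeriv]
  simp only [add_apply, ContinuousLinearMap.comp_apply, ContinuousLinearMap.flip_apply, zero_apply,
    map_zero, zero_add]
  linarith

end Exact

end Chart

/-! ### Holomorphic charts -/

section ComplexChart

variable {E : Type*} [NormedAddCommGroup E] [NormedSpace ℂ E]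
  {M : Type*} [TopologicalSpace M] [ChartedSpace E M]

/-- Multiplication by `i`, as a real linear map. -/
noncomputable def mulI (E : Type*) [NormedAddCommGroup E] [NormedSpace ℂ E] : E →L[ℝ] E :=
  Complex.I • ContinuousLinearMap.id ℝ E

theorem mulI_apply (v : E) : mulI E v = Complex.I • v := rfl

theorem mulI_mulI (v : E) : mulI E (mulI E v) = -v := by
  simp [mulI_apply, smul_smul]

variable [IsManifold 𝓘(ℂ, E) ω M]

theorem chartDeriv_complexStructure {p y : M} (hy : y ∈ (chartAt E p).source)
    (v : TangentSpace 𝓘(ℝ, E) y) :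
    chartDeriv p y (complexStructure y v) = mulI E (chartDeriv p y v) := by
  have : IsManifold 𝓘(ℂ, E) 1 M := IsManifold.of_le (n := ω) le_top
  have hyy : y ∈ (chartAt E y).source ∩ (chartAt E p).source := ⟨mem_chart_source E y, hy⟩
  have h1 := hasFDerivWithinAt_tangentCoordChange (I := 𝓘(ℂ, E)) (x := y) (y := p) (z := y)
    (by simpa using hyy)
  have h2 := hasFDerivWithinAt_tangentCoordChange (I := 𝓘(ℝ, E)) (x := y) (y := p) (z := y)
    (by simpa using hyy)
  rw [modelWithCornersSelf_coe, Set.range_id, hasFDerivWithinAt_univ] at h1 h2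
  have h3 : tangentCoordChange 𝓘(ℝ, E) y p y =
      (tangentCoordChange 𝓘(ℂ, E) y p y).restrictScalars ℝ := h2.unique (h1.restrictScalars ℝ)
  have h4 : chartDeriv (E := E) p y = tangentCoordChange 𝓘(ℝ, E) y p y :=
    mfderiv_chartAt_eq_tangentCoordChange (I := 𝓘(ℝ, E)) hy
  rw [h4, h3]
  exact (tangentCoordChange 𝓘(ℂ, E) y p y).map_smul Complex.I v

theorem complexStructure_coordMap {p y : M} (hy : y ∈ (chartAt E p).source) (v : E) :
    complexStructure y (coordMap p y v) = coordMap p y (mulI E v) := by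
  rw [← coordMap_chartDeriv hy (complexStructure y (coordMap p y v)),
    chartDeriv_complexStructure hy, chartDeriv_coordMap hy]

end ComplexChart

/-! ### The maximum principle on a compact manifold -/

section Pluricanonical

variable {E : Type*} [NormedAddCommGroup E] [NormedSpace ℂ E] [FiniteDimensional ℂ E]
  {M : Type*} [TopologicalSpace M] [ChartedSpace E M] [IsManifold 𝓘(ℂ, E) ω M]
  {g : ContMDiffRiemannianMetric 𝓘(ℝ, E) ∞ E (TangentSpace 𝓘(ℝ, E) : M → Type _)}
  {θ : Π x : M, TangentSpace 𝓘(ℝ, E) x →L[ℝ] ℝ} {f : M → ℝ} {U : Set M}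

theorem mdifferentiableAt_complexStructure_coordField {p y : M} (hy : y ∈ (chartAt E p).source)
    (v : E) : DiffFieldAt 𝓘(ℝ, E) (fun x ↦ complexStructure x (coordField p v x)) y := by
  refine (mdifferentiableAt_coordField hy (mulI E v)).congr_of_eventuallyEq ?_
  filter_upwards [(chartAt E p).open_source.mem_nhds hy] with x hx
  rw [coordField_apply, complexStructure_coordMap hx]
  rfl

/-- `dΩ = θ ∧ Ω` in the chart at `p`. -/
theorem lee_of_isKahlerOn (hU : IsOpen U) (hf : ContMDiffOn 𝓘(ℝ, E) 𝓘(ℝ) ∞ f U)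
    (hK : IsKahlerOn U (fun y ↦ Real.exp (-f y) • g.inner y)) {p y : M}
    (hy : y ∈ (chartAt E p).source) (hyU : y ∈ U) (X Y Z : E) :
    fderiv ℝ (chartMetric g.inner p) (chartAt E p y) X (mulI E Y) Z +
      fderiv ℝ (chartMetric g.inner p) (chartAt E p y) Y (mulI E Z) X +
      fderiv ℝ (chartMetric g.inner p) (chartAt E p y) Z (mulI E X) Y =
    fderiv ℝ (f ∘ (chartAt E p).symm) (chartAt E p y) X *
        chartMetric g.inner p (chartAt E p y) (mulI E Y) Z +
      fderiv ℝ (f ∘ (chartAt E p).symm) (chartAt E p y) Y *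
        chartMetric g.inner p (chartAt E p y) (mulI E Z) X +
      fderiv ℝ (f ∘ (chartAt E p).symm) (chartAt E p y) Z *
        chartMetric g.inner p (chartAt E p y) (mulI E X) Y := by
  have hz := mem_chartImage (E := E) hy hyU
  have hdg : DifferentiableAt ℝ (chartMetric g.inner p) (chartAt E p y) :=
    ((contDiffOn_chartMetric g p).contDiffAt ((chartAt E p).open_target.mem_nhds
      hz.1)).differentiableAt (by simp)
  have hdf : DifferentiableAt ℝ (f ∘ (chartAt E p).symm) (chartAt E p y) :=
    ((contDiffOn_chartImage p hf).contDiffAt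
      ((isOpen_chartImage p hU).mem_nhds hz)).differentiableAt (by simp)
  have hderiv : ∀ X Y Z : E, mvfderiv 𝓘(ℝ, E) (fun x ↦ fundamentalForm
      (fun y ↦ Real.exp (-f y) • g.inner y) x (coordField p Y x) (coordField p Z x)) y
        (coordField p X y) = Real.exp (-f y) *
      (fderiv ℝ (chartMetric g.inner p) (chartAt E p y) X (mulI E Y) Z -
        fderiv ℝ (f ∘ (chartAt E p).symm) (chartAt E p y) X *
          chartMetric g.inner p (chartAt E p y) (mulI E Y) Z) := by
    intro X Y Z
    have h1 : HasFDerivAt (fun z ↦ chartMetric g.inner p z (mulI E Y) Z)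
        (((fderiv ℝ (chartMetric g.inner p) (chartAt E p y)).flip (mulI E Y)).flip Z)
        (chartAt E p y) := by
      simpa using (hdg.hasFDerivAt.clm_apply (hasFDerivAt_const (mulI E Y) _)).clm_apply
        (hasFDerivAt_const Z _)
    have h2 := hdf.hasFDerivAt.neg.exp.mul h1
    refine (mvfderiv_coordMap hy h2.differentiableAt ?_ X).trans ?_
    · filter_upwards [(chartAt E p).open_source.mem_nhds hy] with x hx
      simp only [fundamentalForm, ContinuousLinearMap.comp_apply, Function.comp_apply,
        chartMetric_apply g.inner hx, coordField_apply, complexStructure_coordMap hx,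
        (chartAt E p).left_inv hx, Pi.mul_apply, Pi.neg_apply, smul_apply, smul_eq_mul]
    · rw [h2.fderiv]
      simp only [add_apply, smul_apply, ContinuousLinearMap.flip_apply, smul_eq_mul, neg_apply,
        Function.comp_apply, (chartAt E p).left_inv hy, Pi.neg_apply]
      ring
  have h := hK.closed y hyU _ _ _ (mdifferentiableAt_coordField hy X)
    (mdifferentiableAt_coordField hy Y) (mdifferentiableAt_coordField hy Z)
  rw [extDerivTwoForm] at h
  simp only [mlieBracket_coordField hy, map_zero, zero_apply, hderiv] at h
  have h3 : Real.exp (-f y) ≠ 0 := (Real.exp_pos _).ne'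
  refine mul_left_cancel₀ h3 ?_
  linear_combination h

omit [NormedSpace ℂ E] [FiniteDimensional ℂ E] [IsManifold 𝓘(ℂ, E) ω M] in
theorem exists_of_mem_chartImage {p : M} {z : E} (hz : z ∈ chartImage p U) :
    ∃ y ∈ (chartAt E p).source, y ∈ U ∧ chartAt E p y = z :=
  ⟨_, (chartAt E p).map_target hz.1, hz.2, (chartAt E p).right_inv hz.1⟩

/-- A pluricanonical lcK structure, read in a holomorphic chart. -/
theorem IsPluricanonical.isFlatPluricanonical (h : IsPluricanonical g θ) (hU : IsOpen U)
    (hf : ContMDiffOn 𝓘(ℝ, E) 𝓘(ℝ) ∞ f U)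
    (hK : IsKahlerOn U (fun y ↦ Real.exp (-f y) • g.inner y))
    (hθ : ∀ y ∈ U, θ y = mvfderiv 𝓘(ℝ, E) f y) (p : M) :
    IsFlatPluricanonical (mulI E) (chartImage p U) (chartMetric g.inner p) (chartGrad g f p) where
  isOpen := isOpen_chartImage p hU
  contDiffOn_metric := (contDiffOn_chartMetric g p).mono Set.inter_subset_left
  contDiffOn_field := contDiffOn_chartGrad p hU hf
  sq_eq := mulI_mulI
  isScalarProduct _ hz := isScalarProduct_chartMetric hz.1
  hermitian z hz u v := by
    obtain ⟨y, hy, hyU, rfl⟩ := exists_of_mem_chartImage hz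
    rw [chartMetric_apply g.inner hy, chartMetric_apply g.inner hy,
      ← complexStructure_coordMap hy, ← complexStructure_coordMap hy, h.isLCK.hermitian]
  closed z hz u v := by
    have hV := (isOpen_chartImage (E := E) p hU).mem_nhds hz
    have h1 : (fun z ↦ chartMetric g.inner p z (chartGrad g f p z)) =ᶠ[nhds z]
        fderiv ℝ (f ∘ (chartAt E p).symm) := by
      filter_upwards [hV] with w hw using chartMetric_chartGrad hw.1
    rw [h1.fderiv_eq]
    exact fderiv_fderiv_comm ((contDiffOn_chartImage p hf).contDiffAt hV) u v ▸ rfl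
  lee z hz X Y Z := by
    obtain ⟨y, hy, hyU, rfl⟩ := exists_of_mem_chartImage hz
    rw [chartMetric_chartGrad hz.1]
    exact lee_of_isKahlerOn hU hf hK hy hyU X Y Z
  pluricanonical z hz X Y := by
    obtain ⟨y, hy, hyU, rfl⟩ := exists_of_mem_chartImage hz
    have hT := diffFieldAt_dualField (g := g) hU hf hθ hyU
    have h1 := h.nabla_one_one y _ _ (mdifferentiableAt_coordField hy X)
      (mdifferentiableAt_coordField hy Y)
    rw [← covDerivOneForm_coordField hU hf hθ hy hyU, ← covDerivOneForm_coordField hU hf hθ hy hyU,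
      covDerivOneForm_eq_inner g hT (mdifferentiableAt_coordField hy (mulI E Y)),
      coordField_apply, ← complexStructure_coordMap hy, ← complexStructure_coordMap hy]
    rw [nablaOneOne, covDerivOneForm_eq_inner g hT
      (mdifferentiableAt_complexStructure_coordField hy Y)] at h1
    simp only [coordField_apply] at h1
    linarith

omit [FiniteDimensional ℂ E] in
theorem two_lt_finrank_real (hdim : 2 ≤ Module.finrank ℂ E) : 2 < Module.finrank ℝ E := by
  have := finrank_real_of_complex E
  omega

/-- The function `tr (∇T)²`, where `T` is the vector field dual to `θ`. It is `|∇θ|²` for closed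
`θ`, as `∇T` is then self-adjoint. -/
noncomputable def sqNormNabla
    (g : ContMDiffRiemannianMetric 𝓘(ℝ, E) ∞ E (TangentSpace 𝓘(ℝ, E) : M → Type _))
    (θ : Π x : M, TangentSpace 𝓘(ℝ, E) x →L[ℝ] ℝ) (x : M) : ℝ :=
  LinearMap.trace ℝ (TangentSpace 𝓘(ℝ, E) x)
    ((leviCivita g (dualField g θ) x).toLinearMap * (leviCivita g (dualField g θ) x).toLinearMap)

/-- In a holomorphic chart, `∇T` is the antilinear part of the derivative of `T`. -/
theorem IsPluricanonical.leviCivita_coordMap (h : IsPluricanonical g θ) (hU : IsOpen U)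
    (hf : ContMDiffOn 𝓘(ℝ, E) 𝓘(ℝ) ∞ f U)
    (hK : IsKahlerOn U (fun y ↦ Real.exp (-f y) • g.inner y))
    (hθ : ∀ y ∈ U, θ y = mvfderiv 𝓘(ℝ, E) f y) {p y : M} (hy : y ∈ (chartAt E p).source)
    (hyU : y ∈ U) (v : E) :
    leviCivita g (dualField g θ) y (coordMap p y v) =
      coordMap p y (antilinearDeriv (mulI E) (chartGrad g f p) (chartAt E p y) v) := by
  refine inner_ext g fun Z _ ↦ ?_
  have hT := diffFieldAt_dualField (g := g) hU hf hθ hyU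
  have h1 := covDerivOneForm_coordField hU hf hθ hy hyU v (chartDeriv p y (Z y)) (g := g)
  rw [covDerivOneForm_eq_inner g hT (mdifferentiableAt_coordField hy _), coordField_apply,
    (h.isFlatPluricanonical hU hf hK hθ p).flatCovDeriv_eq (mem_chartImage hy hyU),
    chartMetric_apply g.inner hy, coordMap_chartDeriv hy] at h1
  exact h1

/-- `|∇θ|²` read in the chart at `p`. -/
theorem IsPluricanonical.sqNormNabla_eq (h : IsPluricanonical g θ) (hU : IsOpen U)
    (hf : ContMDiffOn 𝓘(ℝ, E) 𝓘(ℝ) ∞ f U)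
    (hK : IsKahlerOn U (fun y ↦ Real.exp (-f y) • g.inner y))
    (hθ : ∀ y ∈ U, θ y = mvfderiv 𝓘(ℝ, E) f y) {p y : M} (hy : y ∈ (chartAt E p).source)
    (hyU : y ∈ U) :
    sqNormNabla g θ y =
      traceCLM E (antilinearDeriv (mulI E) (chartGrad g f p) (chartAt E p y) *
        antilinearDeriv (mulI E) (chartGrad g f p) (chartAt E p y)) := by
  let e : E ≃ₗ[ℝ] TangentSpace 𝓘(ℝ, E) y :=
    { toLinearMap := (coordMap p y).toLinearMap
      invFun := chartDeriv p y
      left_inv := chartDeriv_coordMap hy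
      right_inv := coordMap_chartDeriv hy }
  have he : ∀ v, e v = coordMap p y v := fun _ ↦ rfl
  have key : (leviCivita g (dualField g θ) y).toLinearMap *
      (leviCivita g (dualField g θ) y).toLinearMap =
      e.conj (antilinearDeriv (mulI E) (chartGrad g f p) (chartAt E p y) *
        antilinearDeriv (mulI E) (chartGrad g f p) (chartAt E p y)).toLinearMap := by
    ext w
    obtain ⟨v, rfl⟩ := e.surjective w
    have hc := h.leviCivita_coordMap hU hf hK hθ hy hyU
    rw [LinearEquiv.conj_apply_apply, e.symm_apply_apply, Module.End.mul_apply, he, he]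
    change leviCivita g (dualField g θ) y (leviCivita g (dualField g θ) y (coordMap p y v)) = _
    rw [hc, hc]
    rfl
  rw [sqNormNabla, key, LinearMap.trace_conj', traceCLM_apply]

theorem IsPluricanonical.continuous_sqNormNabla (h : IsPluricanonical g θ) :
    Continuous (sqNormNabla g θ) := by
  refine continuous_iff_continuousAt.2 fun p ↦ ?_
  obtain ⟨U, hU, hpU, f, hf, hK, hθ⟩ := h.isLCK.conformally_kahler p
  have hp := mem_chart_source E p
  have hF := h.isFlatPluricanonical hU hf hK hθ p
  have hS := ((contDiffOn_antilinearDeriv (J := mulI E) hF.isOpen hF.contDiffOn_field).contDiffAt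
    (hF.isOpen.mem_nhds (mem_chartImage hp hpU))).continuousAt
  have h1 : ContinuousAt (fun y ↦ traceCLM E
      (antilinearDeriv (mulI E) (chartGrad g f p) (chartAt E p y) *
        antilinearDeriv (mulI E) (chartGrad g f p) (chartAt E p y))) p :=
    ContinuousAt.comp (f := chartAt E p) ((traceCLM E).continuous.continuousAt.comp (hS.mul hS))
      ((chartAt E p).continuousAt hp)
  refine h1.congr ?_
  filter_upwards [(chartAt E p).open_source.mem_nhds hp, hU.mem_nhds hpU] with x hx hxU
  exact (h.sqNormNabla_eq hU hf hK hθ hx hxU).symm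

theorem IsPluricanonical.sqNormNabla_eq_zero_of_isMax (h : IsPluricanonical g θ)
    (hdim : 2 ≤ Module.finrank ℂ E) {p : M} (hmax : ∀ x, sqNormNabla g θ x ≤ sqNormNabla g θ p) :
    sqNormNabla g θ p = 0 := by
  obtain ⟨U, hU, hpU, f, hf, hK, hθ⟩ := h.isLCK.conformally_kahler p
  have hp := mem_chart_source E p
  have hF := h.isFlatPluricanonical hU hf hK hθ p
  have hpV := mem_chartImage (E := E) hp hpU
  rw [h.sqNormNabla_eq hU hf hK hθ hp hpU, hF.antilinearDeriv_eq_zero hpV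
    (two_lt_finrank_real hdim), mul_zero, map_zero]
  filter_upwards [hF.isOpen.mem_nhds hpV] with z hz
  obtain ⟨y, hy, hyU, rfl⟩ := exists_of_mem_chartImage hz
  rw [← h.sqNormNabla_eq hU hf hK hθ hp hpU, ← h.sqNormNabla_eq hU hf hK hθ hy hyU]
  exact hmax y

theorem IsPluricanonical.leviCivita_dualField_eq_zero (h : IsPluricanonical g θ) {x : M}
    (hx : sqNormNabla g θ x ≤ 0) (v : TangentSpace 𝓘(ℝ, E) x) :
    leviCivita g (dualField g θ) x v = 0 := by
  obtain ⟨U, hU, hxU, f, hf, hK, hθ⟩ := h.isLCK.conformally_kahler x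
  have hxs := mem_chart_source E x
  have hF := h.isFlatPluricanonical hU hf hK hθ x
  have hxV := mem_chartImage (E := E) hxs hxU
  rw [h.sqNormNabla_eq hU hf hK hθ hxs hxU] at hx
  have h1 := (hF.isScalarProduct _ hxV).trace_sq (hF.antilinearDeriv_symm hxV)
  rw [← coordMap_chartDeriv hxs v, h.leviCivita_coordMap hU hf hK hθ hxs hxU,
    h1.2 (le_antisymm hx h1.1), zero_apply, map_zero]

end Pluricanonical

end LCK

theorem theorem1 {E : Type*} [NormedAddCommGroup E] [NormedSpace ℂ E] [FiniteDimensional ℂ E]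
    (hdim : 2 ≤ Module.finrank ℂ E)
    {M : Type*} [TopologicalSpace M] [T2Space M] [CompactSpace M] [ChartedSpace E M]
    [IsManifold 𝓘(ℂ, E) ω M]
    (g : ContMDiffRiemannianMetric 𝓘(ℝ, E) ∞ E (TangentSpace 𝓘(ℝ, E) : M → Type _))
    (θ : Π x : M, TangentSpace 𝓘(ℝ, E) x →L[ℝ] ℝ)
    (h : LCK.IsPluricanonical g θ) :
    LCK.IsVaisman g θ := by
  refine ⟨h.isLCK, fun x v Y hY ↦ ?_⟩
  obtain ⟨p, -, hp⟩ := isCompact_univ.exists_isMaxOn ⟨x, Set.mem_univ x⟩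
    h.continuous_sqNormNabla.continuousOn
  have hmax : ∀ y, LCK.sqNormNabla g θ y ≤ LCK.sqNormNabla g θ p := fun y ↦ hp (Set.mem_univ y)
  obtain ⟨U, hU, hxU, f, hf, -, hθ⟩ := h.isLCK.conformally_kahler x
  rw [LCK.covDerivOneForm_eq_inner g (LCK.diffFieldAt_dualField hU hf hθ hxU) hY,
    h.leviCivita_dualField_eq_zero
      ((hmax x).trans_eq (h.sqNormNabla_eq_zero_of_isMax hdim hmax)) v, map_zero, zero_apply]
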